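/- Let $k$ be a field of characteristic $0$, $X$ a smooth (not necessarily irreducible) $k$-scheme and $I\subset\mathcal O_X$ a coherent ideal sheaf. **Notation.** For $x\in X$ put $\operatorname{ord}_xI=\sup\{r: I\mathcal O_{X,x}\subset \mathfrak m_x^r\}$ and $\operatorname{max\text{-}ord} I=\sup_{x\in X}\operatorname{ord}_xI$. For a closed subscheme $Z\subset X$, $\operatorname{ord}_ZI\ge m$ (resp. $=m$) means that $\operatorname{ord}_\eta I\ge m$ (resp. $=m$) at every generic point $\eta$ of $Z$. Let $D(I)$ be the ideal sheaf generated by the local sections of $I$ and all their derivatives under local $k$-derivations of $\mathcal O_X$, and $D^{j+1}(I)=D(D^j(I))$. For an ideal sheaf $J$ of finite maximal order $n$: if $n\ge1$, put $MC(J):=D^{n-1}(J)$, and call $J$ *MC-invariant* if $MC(J)\cdot D(J)\subset J$; $J$ is *$D$-balanced* if $(D^i(J))^{n}\subset J^{\,n-i}$ for all $i<n$. With $m=\operatorname{max\text{-}ord} I$, the *maximal coefficient ideal* of order $s\ge0$ is $$W_s(I):=\Bigl(\prod_{j=0}^{m}\bigl(D^j(I)\bigr)^{c_j}:\ c_j\ge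 0,\ \sum_{j}(m-j)c_j\ge s\Bigr)\subset\mathcal O_X .$$ A *smooth blow-up sequence* starting with $X$ is a finite chain $X_r\to\cdots\to X_1\to X_0=X$ with $\pi_i:X_{i+1}\to X_i$ the blow-up of a specified smooth closed subscheme $Z_i$ of the smooth scheme $X_i$ (trivial and empty blow-ups are allowed); let $F_{i+1}=\pi_i^{-1}(Z_i)$. It is *of order $\ge m$* starting with $(X,I,m)$ if, with $I_0=I$ and $I_{i+1}=\mathcal O(mF_{i+1})\cdot\pi_i^*I_i$ ($\pi_i^*$ being the inverse image ideal sheaf), one has $\operatorname{ord}_{Z_i}I_i\ge m$ for every $i$; it is *of order $m$* starting with $(X,I)$ if moreover $\operatorname{ord}_{Z_i}I_i=m$ for every $i$. If $E=(E^1,\dots,E^q)$ is an ordered set of smooth divisors (possibly reducible or empty) whose sum has simple normal crossings, the sequence is *of order $\ge m$ starting with $(X,I,m,E)$* if in addition each $Z_i$ has simple normal crossings with $E_i$, where $E_0=E$ and $E_{i+1}$ consists of the birational transforms of the members of $E_i$ (the closures of their preimages outside $Z_i$), in the same order, followed by $F_{i+1}$. **Theorem.** Assume that $m=\operatorname{max\text{-}ord}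 I$ is finite and $m\ge 1$, and let $L=\operatorname{lcm}(2,\dots,m)$ ($L=1$ if $m=1$). Write $W_s=W_s(I)$. (A) For all integers $s,t,r,j\ge0$: 1. $W_{s+1}\subset W_s$; 2. $W_s\cdot W_t\subset W_{s+t}$; 3. $D(W_{s+1})=W_s$; 4. $MC(W_s)=W_1$ if $s\ge 1$, and $W_1=MC(I)$; 5. $\operatorname{max\text{-}ord} W_s=s$, and $W_s$ is MC-invariant if $s\ge1$; 6. $W_{rL}\cdot W_t=W_{rL+t}$ if $t\ge (m-1)L$; 7. $(W_{rL})^j=W_{jrL}$ if $r\ge m-1$. (B) Let $s=rL$ with $r\ge m-1$ and $r\ge 1$, or let $s=m!$. Then 1. $W_s$ is MC-invariant and $D$-balanced; 2. for every ordered simple normal crossing divisor $E$ on $X$, a smooth blow-up sequence starting with $X$ is of order $\ge m$ starting with $(X,I,m,E)$ if and only if it is of order $\ge s$ starting with $(X,W_s,s,E)$; 3. a smooth blow-up sequence starting with $X$ is of order $\ge m$ starting with $(X,I,m)$ if and only if it is of order $\ge s$ starting with $(X,W_s,s)$; and it is of order $m$ starting with $(X,I)$ if and only if it is of order $s$ starting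 with $(X,W_s)$. -/

import Mathlib

open AlgebraicGeometry CategoryTheory TopologicalSpace

universe u

noncomputable section

namespace IdealTuning

/-! ### Orders of vanishing -/

section Order

variable {X : Scheme.{u}}

/-- The ideal `I · 𝒪_{X,x}` of the local ring `𝒪_{X,x}`. -/
def stalkIdeal (I : X.IdealSheafData) (x : X) : Ideal (X.presheaf.stalk x) :=
  ⨆ (U : X.affineOpens) (hU : x ∈ U.1), (I.ideal U).map (X.presheaf.germ U.1 x hU).hom

/-- The order of vanishing `ord_x I = sup {r | I · 𝒪_{X,x} ⊆ m_x ^ r}`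
(it is `⊤` if `I · 𝒪_{X,x} = 0`). -/
def ordAt (I : X.IdealSheafData) (x : X) : ℕ∞ :=
  ⨆ (r : ℕ) (_ : stalkIdeal I x ≤ IsLocalRing.maximalIdeal (X.presheaf.stalk x) ^ r), (r : ℕ∞)

/-- The maximal order of vanishing `max-ord I`. -/
def maxOrd (I : X.IdealSheafData) : ℕ∞ :=
  ⨆ x : X, ordAt I x

/-- `z` is the generic point of an irreducible component of the closed subscheme defined by `Z`. -/
def IsGenericPointOf (Z : X.IdealSheafData) (z : X) : Prop :=
  z ∈ Z.support ∧ ∀ y ∈ Z.support, y ⤳ z → y = z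

/-- `ord_Z I ≥ m`: the order of `I` is at least `m` at every generic point of `Z`. -/
def OrdAlongGE (Z I : X.IdealSheafData) (m : ℕ) : Prop :=
  ∀ z, IsGenericPointOf Z z → (m : ℕ∞) ≤ ordAt I z

/-- `ord_Z I = m`: the order of `I` is `m` at every generic point of `Z`. -/
def OrdAlongEq (Z I : X.IdealSheafData) (m : ℕ) : Prop :=
  ∀ z, IsGenericPointOf Z z → ordAt I z = (m : ℕ∞)

end Order

/-! ### Derivative ideals and maximal coefficient ideals -/

section Derivative

variable {k : Type u} [Field k] {X : Scheme.{u}}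

/-- The ring homomorphism `k → Γ(X, U)` for a `k`-scheme `f : X ⟶ Spec k`. -/
def constants (f : X ⟶ Spec (.of k)) (U : X.Opens) : k →+* Γ(X, U) :=
  ((Scheme.ΓSpecIso (.of k)).inv ≫ f.appLE ⊤ U le_top).hom

/-- The `k`-linear derivations of the `k`-algebra `Γ(X, U)`. -/
abbrev SectionDerivation (f : X ⟶ Spec (.of k)) (U : X.Opens) : Type u :=
  letI : Algebra k Γ(X, U) := (constants f U).toAlgebra
  Derivation k Γ(X, U) Γ(X, U)

/-- The derivative ideal `D(I)`: the ideal sheaf generated by the local sections of `I` and all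
their derivatives, that is, the smallest ideal sheaf that contains `I` and contains `δ g` for every
affine open `U`, every section `g ∈ I(U)` and every `k`-derivation `δ` of `𝒪_X(U)`.
(In positive dimension the sections of `I` are themselves in the ideal generated by the
derivatives, since `g = ∂(x g)/∂x - x ∂g/∂x`.) -/
def derivIdeal (f : X ⟶ Spec (.of k)) (I : X.IdealSheafData) : X.IdealSheafData :=
  sInf {J | I ≤ J ∧ ∀ (U : X.affineOpens) (δ : SectionDerivation f U.1) (g : Γ(X, U.1)),
    g ∈ I.ideal U → δ g ∈ J.ideal U}

/-- The iterated derivative ideal `D^j(I)`. -/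
def iterDerivIdeal (f : X ⟶ Spec (.of k)) (j : ℕ) (I : X.IdealSheafData) : X.IdealSheafData :=
  (derivIdeal f)^[j] I

/-- The maximal contact ideal `MC(I) = D^{m-1}(I)`, where `m = max-ord I`
(meaningful when `m` is a positive natural number). -/
def maxContactIdeal (f : X ⟶ Spec (.of k)) (I : X.IdealSheafData) : X.IdealSheafData :=
  iterDerivIdeal f ((maxOrd I).toNat - 1) I

/-- The maximal coefficient ideal
`W_s(I) = (∏_{j=0}^m D^j(I)^{c_j} : ∑_j (m - j) c_j ≥ s)`, where `m = max-ord I`. -/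
def maxCoeffIdeal (f : X ⟶ Spec (.of k)) (s : ℕ) (I : X.IdealSheafData) : X.IdealSheafData :=
  let m := (maxOrd I).toNat
  ⨆ (c : ℕ → ℕ) (_ : s ≤ ∑ j ∈ Finset.range (m + 1), (m - j) * c j),
    ∏ j ∈ Finset.range (m + 1), iterDerivIdeal f j I ^ c j

/-- `I` is maximal contact invariant: `MC(I) · D(I) ⊆ I`. -/
def IsMCInvariant (f : X ⟶ Spec (.of k)) (I : X.IdealSheafData) : Prop :=
  maxContactIdeal f I * derivIdeal f I ≤ I

/-- `I` is `D`-balanced: `D^i(I) ^ m ⊆ I ^ (m - i)` for all `i < m`, where `m = max-ord I`. -/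
def IsDBalanced (f : X ⟶ Spec (.of k)) (I : X.IdealSheafData) : Prop :=
  let m := (maxOrd I).toNat
  ∀ i < m, iterDerivIdeal f i I ^ m ≤ I ^ (m - i)

end Derivative

/-! ### Blow-ups and transforms -/

section BlowUp

variable {X X' : Scheme.{u}}

/-- `I` is an invertible ideal sheaf: it is locally generated by a non-zero-divisor. -/
def IsInvertibleIdeal (I : X.IdealSheafData) : Prop :=
  ∀ x : X, ∃ U : X.affineOpens, x ∈ U.1 ∧
    ∃ g ∈ nonZeroDivisors Γ(X, U.1), I.ideal U = Ideal.span {g}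

/-- `π : X' ⟶ X` is the blow-up of the closed subscheme of `X` with ideal sheaf `Z`:
the inverse image ideal sheaf of `Z` is invertible, and `π` is universal with this property.
The exceptional divisor is the closed subscheme with ideal sheaf `Z.comap π`. -/
structure IsBlowUp (π : X' ⟶ X) (Z : X.IdealSheafData) : Prop where
  isInvertibleIdeal : IsInvertibleIdeal (Z.comap π)
  existsUnique_lift : ∀ (T : Scheme.{u}) (g : T ⟶ X), IsInvertibleIdeal (Z.comap g) →
    ∃! h : T ⟶ X', h ≫ π = g

/-- The birational transform `π⁻¹_*(I, m) = 𝒪(m F) · π^* I` of the marked ideal `(I, m)` under the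
blow-up `π` of `Z` with exceptional divisor `F`. It is the largest ideal sheaf `J` with
`𝒪(-m F) · J ⊆ π^* I`; as `𝒪(-F)` is invertible, this is `𝒪(m F) · π^* I` as soon as
`π^* I ⊆ 𝒪(-m F)`, and it is only used when `ord_Z I ≥ m`. -/
def birationalTransform (π : X' ⟶ X) (Z I : X.IdealSheafData) (m : ℕ) : X'.IdealSheafData :=
  sSup {J | (Z.comap π) ^ m * J ≤ I.comap π}

/-- The birational (strict) transform of a divisor `E` under the blow-up `π` of `Z`:
the closure of `π⁻¹(E \ Z)` with its reduced structure. -/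
def strictTransform (π : X' ⟶ X) (Z E : X.IdealSheafData) : X'.IdealSheafData :=
  Scheme.IdealSheafData.vanishingIdeal
    (Closeds.closure (π ⁻¹' ((E.support : Set X) \ (Z.support : Set X))))

/-- The total transform of an ordered set of divisors: the birational transforms, in the same
order, followed by the exceptional divisor. -/
def totalTransform (π : X' ⟶ X) (Z : X.IdealSheafData) (E : List X.IdealSheafData) :
    List X'.IdealSheafData :=
  E.map (strictTransform π Z) ++ [Z.comap π]

end BlowUp

/-! ### Simple normal crossings -/

section SNC

variable {k : Type u} [Field k] {X : Scheme.{u}}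

/-- `z` is a system of local coordinates at `x`: a regular system of parameters of `𝒪_{X,x}`. -/
def IsLocalCoordinates (x : X) {n : ℕ} (z : Fin n → X.presheaf.stalk x) : Prop :=
  Ideal.span (Set.range z) = IsLocalRing.maximalIdeal (X.presheaf.stalk x) ∧
    ringKrullDim (X.presheaf.stalk x) = n

/-- In a neighborhood of `x`, the members of `E` that pass through `x` are
given by pairwise different coordinates among the `z_j`. -/
def AreCoordinateDivisors (E : List X.IdealSheafData) (x : X) {n : ℕ}
    (z : Fin n → X.presheaf.stalk x) : Prop :=
  ∃ c : {i : Fin E.length // x ∈ (E.get i).support} → Fin n,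
    Function.Injective c ∧ ∀ i, stalkIdeal (E.get i.1) x = Ideal.span {z (c i)}

/-- `E` is an ordered set of smooth divisors (each possibly reducible or empty) whose sum has
simple normal crossings. -/
def IsSNCDivisor (f : X ⟶ Spec (.of k)) (E : List X.IdealSheafData) : Prop :=
  (∀ D ∈ E, Smooth (D.subschemeι ≫ f)) ∧
    ∀ x : X, ∃ (n : ℕ) (z : Fin n → X.presheaf.stalk x),
      IsLocalCoordinates x z ∧ AreCoordinateDivisors E x z

/-- The closed subscheme `Z` has simple normal crossings with `E`: at every point of `Z` there are
local coordinates such that the members of `E` through the point are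
given by different coordinates and `Z` is given by the vanishing of some of the coordinates. -/
def HasSNCWith (Z : X.IdealSheafData) (E : List X.IdealSheafData) : Prop :=
  ∀ x ∈ Z.support, ∃ (n : ℕ) (z : Fin n → X.presheaf.stalk x),
    IsLocalCoordinates x z ∧ AreCoordinateDivisors E x z ∧
      ∃ S : Set (Fin n), stalkIdeal Z x = Ideal.span (z '' S)

end SNC

/-! ### Smooth blow-up sequences -/

/-- A smooth blow-up sequence `X_r → ⋯ → X_1 → X_0 = X` over `k`, with specified centers: each
step is the blow-up of a smooth closed subscheme of a smooth `k`-scheme.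
Trivial blow-ups and empty blow-ups are allowed. -/
inductive SmoothBlowUpSeq {k : Type u} [Field k] :
    {X : Scheme.{u}} → (X ⟶ Spec (.of k)) → Type (u + 1)
  | nil {X : Scheme.{u}} (f : X ⟶ Spec (.of k)) : SmoothBlowUpSeq f
  | cons {X X' : Scheme.{u}} (f : X ⟶ Spec (.of k)) (Z : X.IdealSheafData) (π : X' ⟶ X)
      (smooth : Smooth f) (smooth_center : Smooth (Z.subschemeι ≫ f)) (isBlowUp : IsBlowUp π Z)
      (tail : SmoothBlowUpSeq (π ≫ f)) : SmoothBlowUpSeq f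

namespace SmoothBlowUpSeq

variable {k : Type u} [Field k]

/-- The sequence has order `≥ m` for the marked ideal `(I, m)`: with `I_0 = I` and
`(I_{i+1}, m) = (π_i)⁻¹_*(I_i, m)`, one has `ord_{Z_i} I_i ≥ m` for every center `Z_i`. -/
def HasOrderGE {X : Scheme.{u}} {f : X ⟶ Spec (.of k)} :
    SmoothBlowUpSeq f → X.IdealSheafData → ℕ → Prop
  | nil _, _, _ => True
  | cons _ Z π _ _ _ tail, I, m =>
      OrdAlongGE Z I m ∧ tail.HasOrderGE (birationalTransform π Z I m) m

/-- The sequence has order `m` for the ideal `I`: with `I_0 = I` and `I_{i+1} = (π_i)⁻¹_* I_i`, one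
has `ord_{Z_i} I_i = m` for every center `Z_i`. (As every component of `Z_i` has order `m`, the
birational transform of `I_i` is that of the marked ideal `(I_i, m)`.) -/
def HasOrderEq {X : Scheme.{u}} {f : X ⟶ Spec (.of k)} :
    SmoothBlowUpSeq f → X.IdealSheafData → ℕ → Prop
  | nil _, _, _ => True
  | cons _ Z π _ _ _ tail, I, m =>
      OrdAlongEq Z I m ∧ tail.HasOrderEq (birationalTransform π Z I m) m

/-- All centers have simple normal crossings with `E` and its successive total transforms. -/
def HasSNC {X : Scheme.{u}} {f : X ⟶ Spec (.of k)} :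
    SmoothBlowUpSeq f → List X.IdealSheafData → Prop
  | nil _, _ => True
  | cons _ Z π _ _ _ tail, E => HasSNCWith Z E ∧ tail.HasSNC (totalTransform π Z E)

/-- The sequence is a smooth blow-up sequence of order `≥ m` starting with `(X, I, m, E)`. -/
def IsOfOrderGE {X : Scheme.{u}} {f : X ⟶ Spec (.of k)} (B : SmoothBlowUpSeq f)
    (I : X.IdealSheafData) (m : ℕ) (E : List X.IdealSheafData) : Prop :=
  B.HasSNC E ∧ B.HasOrderGE I m

end SmoothBlowUpSeq

end IdealTuning

end

/-! In characteristic zero, orders are read off from derivatives: `I` has order `> n` at `x` exactly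
when `D^n(I)` lies in the prime of `x` (`succ_le_ordAt_iff`). One direction is the Leibniz rule. The
other uses an Euler derivation along a smooth quotient by `P`, which acts on `P^n / P^(n+1)` as
multiplication by `n`.

In `W_s` the factor `D^j(I)` has weight `m - j`, its guaranteed order wherever `I` has order at
least `m`. Hence `W` is a decreasing multiplicative filtration, and Leibniz gives `D(W_(s+1)) ⊆
W_s`. The reverse inclusion (`le_diffIdeal_filtration`) holds because `D(W_1) = D^m(I)` is the unit
ideal. MC-invariance then reads `W_1 * W_(s-1) ⊆ W_s`.

The equalities between products are combinatorial: a monomial of large weight contains a submonomial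
of weight exactly `L`, by pigeonhole, since every weight `1, ..., m` divides `L`. They make powers
of `W_s` equal to `W_(ns)` for the tuned `s`, and D-balancedness follows. The value `s = m!` is of
the form `r * L` with `r ≥ m - 1` except for `m = 3, 4, 5`, where exact splittings are found by
hand.

For blow-up sequences write `s = a * m`. Derivatives commute with birational transforms only up to
inclusion, so the equation `W = W_s(I)` is replaced by the invariant `I^a ⊆ W ⊆ coeffIdeal f m s I`,
with `m` a fixed marking rather than the maximal order of the transform. The left inclusion bounds
the order of `I` from below by that of `W`, the right one does the opposite, and their strict forms
give equality of orders. Both persist (`birationalTransform_pow_le`,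
`birationalTransform_le_coeffIdeal`). The second rests on lifting `e * δ` to the blow-up, where `e`
is an equation of the exceptional divisor; the lift comes from the universal property applied over
dual numbers (`exists_derivation_lift`). -/

noncomputable section

namespace IdealTuning

/-! ### Derivations of smooth algebras and powers of ideals with smooth quotient. -/

section Algebra

open Algebra

variable {k A B : Type*} [Field k] [CommRing A] [Algebra k A] [CommRing B] [Algebra k B]

/-- A smooth algebra has finitely many derivations through which every derivation factors. -/
theorem exists_derivation_basis (k A : Type*) [Field k] [CommRing A] [Algebra k A]
    [Module.Projective A (Ω[A⁄k])] [Module.Finite A (Ω[A⁄k])] :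
    ∃ (n : ℕ) (δ : Fin n → Derivation k A A),
      ∀ {M : Type*} [AddCommGroup M] [Module A M] [Module k M] [IsScalarTower k A M]
        (d : Derivation k A M), ∃ h : Fin n → M, ∀ a, d a = ∑ i, δ i a • h i := by
  obtain ⟨n, p, hp⟩ := Module.Finite.exists_fin' A (Ω[A⁄k])
  obtain ⟨s, hs⟩ := Module.projective_lifting_property p LinearMap.id hp
  -- Coordinates of a splitting of a free cover of the Kähler differentials: a dual basis of a
  -- finite projective module.
  refine ⟨n, fun i => ((LinearMap.proj i).comp s).compDer (KaehlerDifferential.D k A), ?_⟩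
  intro M _ _ _ _ d
  refine ⟨fun i => d.liftKaehlerDifferential (p (Pi.single i 1)), fun a => ?_⟩
  conv_lhs => rw [← d.liftKaehlerDifferential_comp_D, ← LinearMap.id_apply (R := A)
    (KaehlerDifferential.D k A a), ← hs]
  rw [LinearMap.comp_apply, ← LinearMap.comp_apply d.liftKaehlerDifferential p,
    LinearMap.pi_apply_eq_sum_univ]
  simp only [LinearMap.comp_apply]
  refine Finset.sum_congr rfl fun i _ => ?_
  congr 3
  ext j
  simp [Pi.single_apply, eq_comm]

/-- A derivation extends along a formally étale algebra. -/
theorem exists_derivation_extension [Algebra A B] [IsScalarTower k A B] [FormallyEtale A B]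
    (δ : Derivation k A A) :
    ∃ δ' : Derivation k B B, ∀ a, δ' (algebraMap A B a) = algebraMap A B (δ a) := by
  let e := KaehlerDifferential.tensorKaehlerEquivOfFormallyEtale k A B
  let d : Derivation k A B := (Algebra.linearMap A B).compDer δ
  let l : TensorProduct A B (Ω[A⁄k]) →ₗ[B] B :=
    TensorProduct.AlgebraTensorModule.lift
      ((LinearMap.lsmul B (Ω[A⁄k] →ₗ[A] B)).flip d.liftKaehlerDifferential)
  refine ⟨(l.comp e.symm.toLinearMap).compDer (KaehlerDifferential.D k B), fun a => ?_⟩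
  have : e.symm (KaehlerDifferential.D k B (algebraMap A B a)) = _ :=
    KaehlerDifferential.tensorKaehlerEquivOfFormallyEtale_symm_D_algebraMap k A B a
  simp [this, l, d]

/-- The ideal generated by an ideal and its images under all derivations. -/
def diffIdeal (k : Type*) {A : Type*} [Field k] [CommRing A] [Algebra k A] (I : Ideal A) :
    Ideal A :=
  I ⊔ Ideal.span {x | ∃ δ : Derivation k A A, ∃ g ∈ I, δ g = x}

theorem le_diffIdeal (I : Ideal A) : I ≤ diffIdeal k I := le_sup_left

theorem derivation_mem_diffIdeal {I : Ideal A} (δ : Derivation k A A) {g : A} (hg : g ∈ I) :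
    δ g ∈ diffIdeal k I :=
  Ideal.mem_sup_right (Ideal.subset_span ⟨δ, g, hg, rfl⟩)

theorem diffIdeal_le {I J : Ideal A} (h : I ≤ J)
    (h' : ∀ (δ : Derivation k A A), ∀ g ∈ I, δ g ∈ J) : diffIdeal k I ≤ J :=
  sup_le h (Ideal.span_le.2 (by rintro _ ⟨δ, g, hg, rfl⟩; exact h' δ g hg))

theorem derivation_mem_of_span {J : Ideal A} {s : Set A} (δ : Derivation k A A)
    (hs : s ⊆ J) (h : ∀ g ∈ s, δ g ∈ J) {g : A} (hg : g ∈ Ideal.span s) : δ g ∈ J := by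
  induction hg using Submodule.span_induction with
  | mem x hx => exact h x hx
  | zero => simp
  | add x y _ _ hx hy => rw [map_add]; exact add_mem hx hy
  | smul a x hx' hx =>
    rw [smul_eq_mul, Derivation.leibniz]
    exact add_mem (J.smul_mem _ hx) (J.mul_mem_right _ (Ideal.span_le.2 hs hx'))

/-- Derivations of `A` extend to `B`, which gives one inclusion. For the other, a derivation of `B`
restricted to `A` is a `B`-combination of finitely many derivations of `A`, and it suffices to
differentiate the generators coming from `A`. -/
theorem map_diffIdeal [Algebra A B] [IsScalarTower k A B] [FormallyEtale A B]
    [Module.Projective A (Ω[A⁄k])] [Module.Finite A (Ω[A⁄k])] (I : Ideal A) :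
    (diffIdeal k I).map (algebraMap A B) = diffIdeal k (I.map (algebraMap A B)) := by
  apply le_antisymm
  · rw [Ideal.map_le_iff_le_comap]
    refine diffIdeal_le (Ideal.map_le_iff_le_comap.1 (le_diffIdeal _)) fun δ g hg => ?_
    obtain ⟨δ', h⟩ := exists_derivation_extension (B := B) δ
    rw [Ideal.mem_comap, ← h]
    exact derivation_mem_diffIdeal _ (Ideal.mem_map_of_mem _ hg)
  · refine diffIdeal_le (Ideal.map_mono (le_diffIdeal I)) fun δ g hg => ?_
    refine derivation_mem_of_span δ ?_ ?_ hg
    · exact fun x hx => Ideal.map_mono (le_diffIdeal I) (Ideal.subset_span hx)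
    · rintro _ ⟨g, hg, rfl⟩
      obtain ⟨n, β, hb⟩ := exists_derivation_basis k A
      obtain ⟨h, hh⟩ := hb (δ.compAlgebraMap A)
      have := hh g
      rw [Derivation.compAlgebraMap_apply] at this
      rw [this]
      refine sum_mem fun i _ => ?_
      rw [Algebra.smul_def]
      exact Ideal.mul_mem_right _ _ (Ideal.mem_map_of_mem _ (derivation_mem_diffIdeal _ hg))

/-- A smooth quotient admits an Euler derivation. -/
theorem exists_euler_derivation [FormallySmooth k B] (P : Ideal B) [FormallySmooth k (B ⧸ P)] :
    ∃ E : Derivation k B B, (∀ b, E b ∈ P) ∧ ∀ z ∈ P, E z - z ∈ P ^ 2 := by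
  let C := B ⧸ P ^ 2
  let Q : Ideal C := P.map (Ideal.Quotient.mk (P ^ 2))
  have hQ : Q ^ 2 = ⊥ := by
    rw [← Ideal.map_pow, Ideal.map_quotient_self]
  let e : (C ⧸ Q) ≃ₐ[k] (B ⧸ P) :=
    (DoubleQuot.quotQuotEquivQuotOfLEₐ k (Ideal.pow_le_self two_ne_zero))
  -- Formal smoothness of `B ⧸ P` splits the square-zero extension `B ⧸ P ^ 2` of it. The difference
  -- between a class and its projection to the splitting is a derivation into `P / P ^ 2`, and is
  -- the identity there.
  obtain ⟨s, hs⟩ := FormallySmooth.exists_lift (R := k) Q ⟨2, hQ⟩ e.symm.toAlgHom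
  let g : B →ₐ[k] C := s.comp (Ideal.Quotient.mkₐ k P)
  have hg : ∀ b, Ideal.Quotient.mk (P ^ 2) b - g b ∈ Q := fun b => by
    rw [← Ideal.Quotient.eq]
    have := DFunLike.congr_fun hs (Ideal.Quotient.mk P b)
    exact this.symm
  let d : Derivation k B C := Derivation.mk'
    ((Ideal.Quotient.mkₐ k (P ^ 2)).toLinearMap - g.toLinearMap) (by
      intro a b
      have h : (Ideal.Quotient.mk (P ^ 2) a - g a) * (Ideal.Quotient.mk (P ^ 2) b - g b) = 0 := by
        have := Ideal.mul_mem_mul (hg a) (hg b)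
        rwa [← sq, hQ, Ideal.mem_bot] at this
      simp only [LinearMap.sub_apply, AlgHom.toLinearMap_apply, map_mul, Ideal.Quotient.mkₐ_eq_mk,
        Algebra.smul_def]
      linear_combination (-1 : C) * h)
  -- The differentials of the formally smooth `B` are projective, so the derivation lifts from `B ⧸
  -- P ^ 2` to `B`.
  obtain ⟨l, hl⟩ := Module.projective_lifting_property (Ideal.Quotient.mkₐ B (P ^ 2)).toLinearMap
    d.liftKaehlerDifferential Ideal.Quotient.mk_surjective
  have hE : ∀ b, Ideal.Quotient.mk (P ^ 2) (l (KaehlerDifferential.D k B b)) =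
      Ideal.Quotient.mk (P ^ 2) b - g b := fun b => by
    have := LinearMap.congr_fun hl (KaehlerDifferential.D k B b)
    rw [Derivation.liftKaehlerDifferential_comp_D] at this
    exact this
  refine ⟨l.compDer (KaehlerDifferential.D k B), fun b => ?_, fun z hz => ?_⟩
  · have h := hg b
    rw [← hE, Ideal.mem_quotient_iff_mem (Ideal.pow_le_self two_ne_zero)] at h
    exact h
  · have h : g z = 0 := by
      simp only [g, AlgHom.comp_apply, Ideal.Quotient.mkₐ_eq_mk,
        Ideal.Quotient.eq_zero_iff_mem.2 hz, map_zero]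
    rw [← Ideal.Quotient.eq]
    exact (hE z).trans (by rw [h, sub_zero])

/-- Euler's identity: `E` acts as multiplication by `n` on `P ^ n / P ^ (n + 1)`. -/
theorem derivation_sub_mem_pow {P : Ideal B} {E : Derivation k B B} (hE : ∀ b, E b ∈ P)
    (hE' : ∀ z ∈ P, E z - z ∈ P ^ 2) (n : ℕ) {f : B} (hf : f ∈ P ^ n) :
    E f - n * f ∈ P ^ (n + 1) := by
  induction n generalizing f with
  | zero => simpa using hE f
  | succ n ih =>
    rw [pow_succ] at hf
    induction hf using Submodule.mul_induction_on' with
    | mem_mul_mem x hx y hy =>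
      have h1 := Ideal.mul_mem_mul (ih hx) hy
      have h2 := Ideal.mul_mem_mul hx (hE' y hy)
      rw [← pow_succ] at h1
      rw [← pow_add] at h2
      have : E (x * y) - ((n + 1 : ℕ) : B) * (x * y) = (E x - n * x) * y + x * (E y - y) := by
        rw [Derivation.leibniz, smul_eq_mul, smul_eq_mul]; push_cast; ring
      rw [this]
      exact add_mem h1 h2
    | add x _ y _ hx hy =>
      have : E (x + y) - ((n + 1 : ℕ) : B) * (x + y) =
        (E x - ((n + 1 : ℕ) : B) * x) + (E y - ((n + 1 : ℕ) : B) * y) := by rw [map_add]; ring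
      rw [this]
      exact add_mem hx hy

theorem natCast_mul_mem_iff [CharZero k] {P : Ideal B} {n : ℕ} (hn : n ≠ 0) {f : B} :
    (n : B) * f ∈ P ↔ f ∈ P := by
  refine ⟨fun h => ?_, P.mul_mem_left _⟩
  have hu : IsUnit (n : B) := by
    rw [← map_natCast (algebraMap k B)]
    exact (IsUnit.mk0 (n : k) (Nat.cast_ne_zero.2 hn)).map _
  exact (Ideal.unit_mul_mem_iff_mem P hu).1 h

/-- An element of `P ^ n` all of whose derivatives lie in `P ^ n` lies in `P ^ (n + 1)`. -/
theorem mem_pow_succ_of_derivation_mem_pow [CharZero k] [Algebra A B] [IsScalarTower k A B]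
    [Module.Projective A (Ω[A⁄k])] [Module.Finite A (Ω[A⁄k])]
    [FormallySmooth k B] (P : Ideal B) [FormallySmooth k (B ⧸ P)] {n : ℕ} (hn : n ≠ 0) {f : A}
    (hf : algebraMap A B f ∈ P ^ n)
    (h : ∀ δ : Derivation k A A, algebraMap A B (δ f) ∈ P ^ n) :
    algebraMap A B f ∈ P ^ (n + 1) := by
  obtain ⟨E, hE, hE'⟩ := exists_euler_derivation (k := k) P
  obtain ⟨r, β, hb⟩ := exists_derivation_basis k A
  let l := (E.compAlgebraMap A).liftKaehlerDifferential
  have hP : ∀ ω, l ω ∈ P := by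
    intro ω
    have : ω ∈ Submodule.span A (Set.range (KaehlerDifferential.D k A)) := by
      rw [KaehlerDifferential.span_range_derivation]; trivial
    induction this using Submodule.span_induction with
    | mem x hx => obtain ⟨a, rfl⟩ := hx; simpa [l] using hE _
    | zero => simp
    | add x y _ _ hx hy => rw [map_add]; exact add_mem hx hy
    | smul a x _ hx => rw [map_smul, Algebra.smul_def]; exact P.mul_mem_left _ hx
  obtain ⟨w, hw⟩ := hb (KaehlerDifferential.D k A)
  -- Restricted to `A`, `E` is a combination of the `β i` with coefficients in `P`; this gains the
  -- extra factor of `P`, while Euler's identity compares `E f` with `n * f`.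
  have hEf : E (algebraMap A B f) = ∑ i, algebraMap A B (β i f) * l (w i) := by
    have : E (algebraMap A B f) = l (KaehlerDifferential.D k A f) := by simp [l]
    rw [this, hw, map_sum]
    simp [Algebra.smul_def]
  have h2 := derivation_sub_mem_pow hE hE' _ hf
  have h3 : E (algebraMap A B f) ∈ P ^ (n + 1) := by
    rw [hEf, pow_succ]
    exact sum_mem fun i _ => Ideal.mul_mem_mul (h _) (hP _)
  rw [← natCast_mul_mem_iff (k := k) hn]
  simpa using sub_mem h3 h2

/-- If the `n`-fold derivative ideal of `I` vanishes along the smooth quotient `B ⧸ P`, then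
`I` vanishes there to order `n + 1`. -/
theorem map_le_pow_of_iterate_diffIdeal_le [CharZero k] [Algebra A B] [IsScalarTower k A B]
    [Module.Projective A (Ω[A⁄k])] [Module.Finite A (Ω[A⁄k])]
    [FormallySmooth k B] (P : Ideal B) [FormallySmooth k (B ⧸ P)] (n : ℕ) (I : Ideal A)
    (h : ((diffIdeal k)^[n] I).map (algebraMap A B) ≤ P) :
    I.map (algebraMap A B) ≤ P ^ (n + 1) := by
  induction n generalizing I with
  | zero => simpa using h
  | succ n ih =>
    have h1 := ih (diffIdeal k I) (by rwa [← Function.iterate_succ_apply])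
    exact Ideal.map_le_iff_le_comap.2 fun f hf => mem_pow_succ_of_derivation_mem_pow (k := k) P
      n.succ_ne_zero (h1 (Ideal.mem_map_of_mem _ (le_diffIdeal I hf)))
      fun δ => h1 (Ideal.mem_map_of_mem _ (derivation_mem_diffIdeal δ hf))

theorem derivation_mem_pow (P : Ideal B) (δ : Derivation k B B) {n : ℕ} {f : B}
    (hf : f ∈ P ^ (n + 1)) : δ f ∈ P ^ n := by
  induction n generalizing f with
  | zero => simp
  | succ n ih =>
    rw [pow_succ] at hf
    induction hf using Submodule.mul_induction_on' with
    | mem_mul_mem x hx y hy =>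
      rw [Derivation.leibniz, smul_eq_mul, smul_eq_mul]
      refine add_mem (Ideal.mul_mem_right _ _ hx) ?_
      rw [pow_succ, mul_comm y]
      exact Ideal.mul_mem_mul (ih hx) hy
    | add x _ y _ hx hy => rw [map_add]; exact add_mem hx hy

theorem diffIdeal_le_pow {P I : Ideal B} {n : ℕ} (h : I ≤ P ^ (n + 1)) :
    diffIdeal k I ≤ P ^ n :=
  diffIdeal_le (h.trans (Ideal.pow_le_pow_right n.le_succ)) fun δ _ hg =>
    derivation_mem_pow P δ (h hg)

theorem map_iterate_diffIdeal [Algebra A B] [IsScalarTower k A B] [FormallyEtale A B]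
    [Module.Projective A (Ω[A⁄k])] [Module.Finite A (Ω[A⁄k])] (n : ℕ) (I : Ideal A) :
    ((diffIdeal k)^[n] I).map (algebraMap A B) = (diffIdeal k)^[n] (I.map (algebraMap A B)) := by
  induction n generalizing I with
  | zero => rfl
  | succ n ih => rw [Function.iterate_succ_apply, Function.iterate_succ_apply, ih, map_diffIdeal]

theorem iterate_diffIdeal_le_pow {P I : Ideal B} (n : ℕ) {r : ℕ} (h : I ≤ P ^ (n + r)) :
    (diffIdeal k)^[n] I ≤ P ^ r := by
  induction n generalizing I with
  | zero => simpa using h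
  | succ n ih => exact ih (diffIdeal_le_pow (h.trans_eq (by congr 1; ring)))

theorem map_le_pow_succ_iff [CharZero k] [Algebra A B] [IsScalarTower k A B] [FormallyEtale A B]
    [Module.Projective A (Ω[A⁄k])] [Module.Finite A (Ω[A⁄k])]
    [FormallySmooth k B] (P : Ideal B) [FormallySmooth k (B ⧸ P)] (n : ℕ) (I : Ideal A) :
    I.map (algebraMap A B) ≤ P ^ (n + 1) ↔ ((diffIdeal k)^[n] I).map (algebraMap A B) ≤ P := by
  refine ⟨fun h => ?_, map_le_pow_of_iterate_diffIdeal_le P n I⟩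
  rw [map_iterate_diffIdeal]
  exact (iterate_diffIdeal_le_pow n h).trans_eq (pow_one P)

/-- Trades one factor `f` for two factors `δ f` while keeping an excess of one over the expected
order. Applying `δ` to the current product and multiplying by `δ f` changes the order by `n - 1`,
exactly the expected change; the unwanted term contains `δ (δ f)` and has at least the same order.
-/
theorem pow_mul_derivation_pow_mem [CharZero k] {P : Ideal B} (δ : Derivation k B B)
    {n a : ℕ} {f : B} (hf : f ∈ P ^ (n + 1)) (h : f ^ a ∈ P ^ (a * (n + 1) + 1)) (i : ℕ)
    (hi : i ≤ a) : f ^ (a - i) * δ f ^ (2 * i) ∈ P ^ ((a - i) * (n + 1) + 2 * i * n + 1) := by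
  induction i with
  | zero => simpa using h
  | succ i ih =>
    obtain ⟨b, rfl⟩ : ∃ b, a = i + (b + 1) := ⟨a - (i + 1), by omega⟩
    have ih := ih (by omega)
    rw [show i + (b + 1) - i = b + 1 by omega] at ih
    rw [show i + (b + 1) - (i + 1) = b by omega]
    have h1 : δ f ∈ P ^ n := derivation_mem_pow P δ hf
    have h2 : δ (δ f) ∈ P ^ (n - 1) := by
      rcases n with _ | n
      · simp
      · exact derivation_mem_pow P δ h1
    have h3 := Ideal.mul_mem_mul (derivation_mem_pow P δ ih) h1
    have h4 := Ideal.mul_mem_mul ih h2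
    rw [← pow_add] at h3 h4
    rw [← natCast_mul_mem_iff (k := k) b.succ_ne_zero]
    have h5 : ((b + 1 : ℕ) : B) * (f ^ b * δ f ^ (2 * (i + 1))) =
        δ (f ^ (b + 1) * δ f ^ (2 * i)) * δ f -
          ((2 * i : ℕ) : B) * (f ^ (b + 1) * δ f ^ (2 * i) * δ (δ f)) := by
      rw [Derivation.leibniz, Derivation.leibniz_pow, Derivation.leibniz_pow]
      rcases i with _ | i
      · simp [nsmul_eq_mul]; ring
      · rw [show 2 * (i + 1) - 1 = 2 * i + 1 by omega]
        simp only [smul_eq_mul, nsmul_eq_mul, Nat.add_sub_cancel]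
        ring
    rw [h5]
    refine sub_mem (Ideal.pow_le_pow_right ?_ h3) (Ideal.mul_mem_left _ _
      (Ideal.pow_le_pow_right ?_ h4))
    · apply le_of_eq; ring
    -- The subtraction `n - 1` is truncated; only `n ≤ (n - 1) + 1` is needed.
    · obtain ⟨c, hc⟩ : ∃ c, c = n - 1 := ⟨_, rfl⟩
      rw [← hc]
      have : n ≤ c + 1 := by omega
      nlinarith

/-- Descent on the order: if `f ^ a` had excess order, then by trading all factors `(δ f) ^ (2 * a)`
would too, for a `δ` that lowers the order of `f` by exactly one. At order zero this is primality of
`P`. -/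
theorem pow_notMem_of_notMem_pow [CharZero k] [FormallySmooth k B] [Module.Finite B (Ω[B⁄k])]
    (P : Ideal B) [P.IsPrime] [FormallySmooth k (B ⧸ P)] {n : ℕ} {f : B} (hf : f ∈ P ^ n)
    (hf' : f ∉ P ^ (n + 1)) (a : ℕ) : f ^ a ∉ P ^ (a * n + 1) := by
  induction n generalizing f a with
  | zero =>
    intro h
    rw [mul_zero, zero_add, pow_one] at h
    exact hf' (by simpa using Ideal.IsPrime.mem_of_pow_mem ‹_› _ h)
  | succ n ih =>
    intro h
    refine hf' (mem_pow_succ_of_derivation_mem_pow (k := k) (A := B) P n.succ_ne_zero hf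
      fun δ => ?_)
    by_contra hδ
    refine ih (derivation_mem_pow P δ hf) hδ (2 * a) ?_
    simpa using pow_mul_derivation_pow_mem δ hf h a le_rfl

/-- The order of vanishing along a smooth prime is multiplicative on powers of ideals. -/
theorem le_pow_succ_of_pow_le_pow [CharZero k] [FormallySmooth k B] [Module.Finite B (Ω[B⁄k])]
    (P : Ideal B) [P.IsPrime] [FormallySmooth k (B ⧸ P)] {I : Ideal B} {a m : ℕ}
    (h : I ^ a ≤ P ^ (a * m + 1)) : I ≤ P ^ (m + 1) := by
  intro f hf
  by_contra hfm
  classical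
  have hex : ∃ n, f ∉ P ^ n := ⟨_, hfm⟩
  obtain ⟨n, hn⟩ : ∃ n, Nat.find hex = n + 1 := Nat.exists_eq_succ_of_ne_zero fun h0 => by
    have := Nat.find_spec hex
    rw [h0] at this
    simp at this
  have h1 : f ∉ P ^ (n + 1) := hn ▸ Nat.find_spec hex
  have h2 : f ∈ P ^ n := by
    by_contra h
    have := Nat.find_min' hex h
    omega
  have h3 : n ≤ m := by
    have := Nat.find_min' hex hfm
    omega
  exact pow_notMem_of_notMem_pow (k := k) P h2 h1 a
    (Ideal.pow_le_pow_right (Nat.succ_le_succ (Nat.mul_le_mul_left a h3))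
      (h (Ideal.pow_mem_pow hf a)))

theorem formallySmooth_of_isLocalization_atPrime (k : Type*) [Field k] [Algebra k A] [Algebra k B]
    [FormallySmooth k A] [Algebra A B] [IsScalarTower k A B] (q : Ideal A) [q.IsPrime]
    [IsLocalization.AtPrime B q] : FormallySmooth k B :=
  have : FormallyEtale A B := FormallyEtale.of_isLocalization q.primeCompl
  FormallySmooth.comp k A B

theorem essFiniteType_of_isLocalization_atPrime (k : Type*) [Field k] [Algebra k A] [Algebra k B]
    [EssFiniteType k A] [Algebra A B] [IsScalarTower k A B] (q : Ideal A) [q.IsPrime]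
    [IsLocalization.AtPrime B q] : EssFiniteType k B :=
  have := EssFiniteType.of_isLocalization B q.primeCompl
  EssFiniteType.comp k A B

/-- The residue field is an essentially finitely generated extension of a field of characteristic
zero, hence separable. -/
theorem formallySmooth_quotient_maximalIdeal (k : Type*) [Field k] [CharZero k] [Algebra k B]
    [EssFiniteType k B] [IsLocalRing B] : FormallySmooth k (B ⧸ IsLocalRing.maximalIdeal B) := by
  have := EssFiniteType.comp k B (B ⧸ IsLocalRing.maximalIdeal B)
  let : Field (B ⧸ IsLocalRing.maximalIdeal B) := Ideal.Quotient.field _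
  infer_instance

/-- An ideal vanishes to order `> n` at a prime `q` if and only if its `n`-fold derivative ideal
is contained in `q`. -/
theorem map_le_maximalIdeal_pow_succ_iff (k : Type*) [Field k] [CharZero k] [Algebra k A]
    [Algebra k B] [FormallySmooth k A] [EssFiniteType k A] [Algebra A B] [IsScalarTower k A B]
    (q : Ideal A) [q.IsPrime] [IsLocalization.AtPrime B q] [IsLocalRing B] (n : ℕ) (I : Ideal A) :
    I.map (algebraMap A B) ≤ IsLocalRing.maximalIdeal B ^ (n + 1) ↔ (diffIdeal k)^[n] I ≤ q := by
  have : FormallyEtale A B := FormallyEtale.of_isLocalization q.primeCompl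
  have := formallySmooth_of_isLocalization_atPrime k (B := B) q
  have := essFiniteType_of_isLocalization_atPrime k (B := B) q
  have := formallySmooth_quotient_maximalIdeal k (B := B)
  rw [map_le_pow_succ_iff (k := k), Ideal.map_le_iff_le_comap, ← Ideal.under_def,
    IsLocalization.AtPrime.under_maximalIdeal B q]

theorem le_maximalIdeal_pow_succ_of_pow_le (k : Type*) [Field k] [CharZero k] [Algebra k A]
    [Algebra k B] [FormallySmooth k A] [EssFiniteType k A] [Algebra A B] [IsScalarTower k A B]
    (q : Ideal A) [q.IsPrime] [IsLocalization.AtPrime B q] [IsLocalRing B] {I : Ideal B}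
    {a m : ℕ} (h : I ^ a ≤ IsLocalRing.maximalIdeal B ^ (a * m + 1)) :
    I ≤ IsLocalRing.maximalIdeal B ^ (m + 1) := by
  have := formallySmooth_of_isLocalization_atPrime k (B := B) q
  have := essFiniteType_of_isLocalization_atPrime k (B := B) q
  have := formallySmooth_quotient_maximalIdeal k (B := B)
  exact le_pow_succ_of_pow_le_pow (k := k) _ h

/-- The zero power of a nilpotent lies in all powers of the maximal ideal, so the nilpotent does as
well by multiplicativity of orders; Krull's intersection theorem kills it. -/
theorem isReduced_of_formallySmooth (k A : Type*) [Field k] [CharZero k] [CommRing A]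
    [Algebra k A] [FormallySmooth k A] [FiniteType k A] : IsReduced A := by
  have hA : IsNoetherianRing A := FiniteType.isNoetherianRing k A
  refine ⟨fun f ⟨a, ha⟩ => eq_zero_of_localization f fun q _ => ?_⟩
  let B := Localization.AtPrime q
  have : IsNoetherianRing B := IsLocalization.isNoetherianRing q.primeCompl B hA
  rw [← Ideal.mem_bot, ← Ideal.iInf_pow_eq_bot_of_isLocalRing (IsLocalRing.maximalIdeal B)
    Ideal.IsPrime.ne_top', Ideal.mem_iInf]
  intro n
  refine Ideal.pow_le_pow_right n.le_succ ?_
  rw [← Ideal.span_singleton_le_iff_mem]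
  refine le_maximalIdeal_pow_succ_of_pow_le k q (a := a + 1) ?_
  rw [Ideal.span_singleton_pow, ← map_pow, pow_succ, ha, zero_mul, map_zero]
  simp

/-- A smooth quotient is reduced, so containment in `P` can be tested on its minimal primes. -/
theorem le_pow_of_iterate_diffIdeal_le_minimalPrimes [CharZero k] [FormallySmooth k A]
    [FiniteType k A] (P : Ideal A) [FormallySmooth k (A ⧸ P)] (n : ℕ) (I : Ideal A)
    (h : ∀ q ∈ P.minimalPrimes, (diffIdeal k)^[n] I ≤ q) : I ≤ P ^ (n + 1) := by
  have hr : IsReduced (A ⧸ P) := isReduced_of_formallySmooth k (A ⧸ P)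
  have hP : P.radical = P := ((Ideal.isRadical_iff_quotient_reduced P).2 hr).radical
  have := map_le_pow_of_iterate_diffIdeal_le (k := k) (A := A) (B := A) P n I ?_
  · simpa using this
  · rw [← hP, ← Ideal.sInf_minimalPrimes]
    simpa using! le_sInf h

end Algebra

/-! ### Derivative ideal sheaves on affine opens, and ideals in stalks. -/

section Sheaf

variable {k : Type u} [Field k] {X : Scheme.{u}}

/-- The `k`-algebra structure on sections over `U`. -/
abbrev sectionAlgebra (f : X ⟶ Spec (.of k)) (U : X.Opens) : Algebra k Γ(X, U) :=
  (constants f U).toAlgebra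

theorem map_comp_constants (f : X ⟶ Spec (.of k)) {U V : X.Opens} (h : U ≤ V) :
    (X.presheaf.map (homOfLE h).op).hom.comp (constants f V) = constants f U := by
  exact congr_arg (fun φ => ((Scheme.ΓSpecIso (.of k)).inv ≫ φ).hom)
    (f.appLE_map (U := ⊤) le_top (homOfLE h).op)

theorem appLE_comp_constants {X' : Scheme.{u}} (π : X' ⟶ X) (f : X ⟶ Spec (.of k)) {U : X.Opens}
    {V : X'.Opens} (h : V ≤ π ⁻¹ᵁ U) :
    (π.appLE U V h).hom.comp (constants f U) = constants (π ≫ f) V := by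
  exact congr_arg (fun φ => ((Scheme.ΓSpecIso (.of k)).inv ≫ φ).hom)
    (Scheme.Hom.appLE_comp_appLE π f ⊤ U V le_top h)

theorem smooth_constants (f : X ⟶ Spec (.of k)) [Smooth f] (U : X.affineOpens) :
    (constants f U.1).Smooth := by
  have h := f.smooth_appLE (isAffineOpen_top _) U.2 le_top
  rw [constants, CommRingCat.hom_comp]
  exact (RingHom.Smooth.respectsIso).2 _ (Scheme.ΓSpecIso (.of k)).symm.commRingCatIsoToRingEquiv h

theorem smooth_sectionAlgebra (f : X ⟶ Spec (.of k)) [Smooth f] (U : X.affineOpens) :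
    letI := sectionAlgebra f U.1
    Algebra.Smooth k Γ(X, U.1) :=
  smooth_constants f U

/-- The derivative ideal, described on affine opens. -/
def diffSheaf (f : X ⟶ Spec (.of k)) [Smooth f] (I : X.IdealSheafData) : X.IdealSheafData where
  ideal U := letI := sectionAlgebra f U.1; diffIdeal k (I.ideal U)
  map_ideal_basicOpen U r := by
    let : Algebra k Γ(X, U.1) := sectionAlgebra f U.1
    let : Algebra k Γ(X, X.basicOpen r) := sectionAlgebra f (X.basicOpen r)
    have := smooth_sectionAlgebra f U
    let : Algebra Γ(X, U.1) Γ(X, X.basicOpen r) :=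
      (X.presheaf.map (homOfLE <| X.basicOpen_le r).op).hom.toAlgebra
    have : IsScalarTower k Γ(X, U.1) Γ(X, X.basicOpen r) :=
      .of_algebraMap_eq' (map_comp_constants f (X.basicOpen_le r)).symm
    have : IsLocalization.Away r Γ(X, X.basicOpen r) := U.2.isLocalization_basicOpen r
    have : Algebra.FormallyEtale Γ(X, U.1) Γ(X, X.basicOpen r) :=
      Algebra.FormallyEtale.of_isLocalization (.powers r)
    have h := map_diffIdeal (k := k) (B := Γ(X, X.basicOpen r)) (I.ideal U)
    have h' := I.map_ideal_basicOpen U r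
    refine h.trans ?_
    exact congr_arg (diffIdeal k) h'

/-- The infimum defining `derivIdeal` is attained: the affine-local derivative ideals commute with
localization, so they glue to a member of the family. This makes its sections computable. -/
theorem derivIdeal_eq_diffSheaf (f : X ⟶ Spec (.of k)) [Smooth f] (I : X.IdealSheafData) :
    derivIdeal f I = diffSheaf f I := by
  apply le_antisymm
  · refine sInf_le ⟨fun U => ?_, fun U δ g hg => ?_⟩
    · let := sectionAlgebra f U.1
      exact le_diffIdeal (k := k) _
    · let := sectionAlgebra f U.1
      exact derivation_mem_diffIdeal δ hg
  · refine le_sInf fun J hJ U => ?_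
    let := sectionAlgebra f U.1
    exact diffIdeal_le (hJ.1 U) fun δ g hg => hJ.2 U δ g hg

theorem le_derivIdeal (f : X ⟶ Spec (.of k)) (I : X.IdealSheafData) : I ≤ derivIdeal f I :=
  le_sInf fun _ hJ => hJ.1

theorem derivIdeal_le {f : X ⟶ Spec (.of k)} {I J : X.IdealSheafData} (h : I ≤ J)
    (h' : ∀ (U : X.affineOpens) (δ : SectionDerivation f U.1) (g : Γ(X, U.1)),
      g ∈ I.ideal U → δ g ∈ J.ideal U) : derivIdeal f I ≤ J :=
  sInf_le ⟨h, h'⟩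

theorem ideal_derivIdeal (f : X ⟶ Spec (.of k)) [Smooth f] (I : X.IdealSheafData)
    (U : X.affineOpens) : letI := sectionAlgebra f U.1
    (derivIdeal f I).ideal U = diffIdeal k (I.ideal U) := by
  rw [derivIdeal_eq_diffSheaf]; rfl

theorem derivation_mem_derivIdeal (f : X ⟶ Spec (.of k)) [Smooth f] {I : X.IdealSheafData}
    {U : X.affineOpens} (δ : SectionDerivation f U.1) {g : Γ(X, U.1)} (hg : g ∈ I.ideal U) :
    δ g ∈ (derivIdeal f I).ideal U := by
  let := sectionAlgebra f U.1
  rw [ideal_derivIdeal]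
  exact derivation_mem_diffIdeal δ hg

theorem ideal_iterDerivIdeal (f : X ⟶ Spec (.of k)) [Smooth f] (I : X.IdealSheafData)
    (U : X.affineOpens) (n : ℕ) : letI := sectionAlgebra f U.1
    (iterDerivIdeal f n I).ideal U = (diffIdeal k)^[n] (I.ideal U) := by
  let := sectionAlgebra f U.1
  induction n with
  | zero => rfl
  | succ n ih =>
    rw [iterDerivIdeal] at ih ⊢
    rw [Function.iterate_succ_apply', Function.iterate_succ_apply', ideal_derivIdeal, ih]

/-! ### Stalks -/

theorem stalkIdeal_eq_map (I : X.IdealSheafData) {x : X} (U : X.affineOpens) (hU : x ∈ U.1) :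
    stalkIdeal I x = (I.ideal U).map (X.presheaf.germ U.1 x hU).hom := by
  apply le_antisymm
  · refine iSup₂_le fun V hV => ?_
    obtain ⟨r, s, hrs, hxr⟩ := exists_basicOpen_le_affine_inter U.2 V.2 x ⟨hU, hV⟩
    let W := X.affineBasicOpen r
    have hx : x ∈ W.1 := hxr
    have hWU : W ≤ U := X.basicOpen_le r
    have hWV : W ≤ V := hrs.trans_le (X.basicOpen_le s)
    have h : ∀ {V : X.affineOpens} (hV : x ∈ V.1) (hWV : W ≤ V),
        (I.ideal V).map (X.presheaf.germ V.1 x hV).hom =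
          (I.ideal W).map (X.presheaf.germ W.1 x hx).hom := fun {V} hV hWV => by
      rw [← I.map_ideal hWV, Ideal.map_map, ← CommRingCat.hom_comp]
      exact congr_arg (fun φ => Ideal.map (CommRingCat.Hom.hom φ) _)
        (X.presheaf.germ_res (homOfLE (X := X.Opens) hWV) x hx).symm
    rw [h hV hWV, h hU hWU]
  · exact le_iSup₂ (f := fun (U : X.affineOpens) (hU : x ∈ U.1) =>
      (I.ideal U).map (X.presheaf.germ U.1 x hU).hom) U hU

theorem exists_affine_mem (x : X) : ∃ U : X.affineOpens, x ∈ U.1 := by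
  obtain ⟨U, hU, hx, -⟩ := exists_isAffineOpen_mem_and_subset (U := (⊤ : X.Opens)) (x := x) trivial
  exact ⟨⟨U, hU⟩, hx⟩

theorem stalkIdeal_mono {I J : X.IdealSheafData} (h : I ≤ J) (x : X) :
    stalkIdeal I x ≤ stalkIdeal J x :=
  iSup₂_mono fun U _ => Ideal.map_mono (h U)

theorem stalkIdeal_mul (I J : X.IdealSheafData) (x : X) :
    stalkIdeal (I * J) x = stalkIdeal I x * stalkIdeal J x := by
  obtain ⟨U, hU⟩ := exists_affine_mem x
  simp only [stalkIdeal_eq_map _ U hU, Scheme.IdealSheafData.ideal_mul, Pi.mul_apply,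
    Ideal.map_mul]

theorem stalkIdeal_pow (I : X.IdealSheafData) (n : ℕ) (x : X) :
    stalkIdeal (I ^ n) x = stalkIdeal I x ^ n := by
  obtain ⟨U, hU⟩ := exists_affine_mem x
  simp only [stalkIdeal_eq_map _ U hU, Scheme.IdealSheafData.ideal_pow, Pi.pow_apply,
    Ideal.map_pow]

theorem stalkIdeal_iSup {ι : Sort*} (I : ι → X.IdealSheafData) (x : X) :
    stalkIdeal (⨆ i, I i) x = ⨆ i, stalkIdeal (I i) x := by
  obtain ⟨U, hU⟩ := exists_affine_mem x
  simp only [stalkIdeal_eq_map _ U hU]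
  rw [iSup, Scheme.IdealSheafData.ideal_sSup, sSup_image, iSup_range, iSup_apply, Ideal.map_iSup]

theorem le_ordAt_iff {I : X.IdealSheafData} {x : X} {m : ℕ} :
    (m : ℕ∞) ≤ ordAt I x ↔
      stalkIdeal I x ≤ IsLocalRing.maximalIdeal (X.presheaf.stalk x) ^ m := by
  refine ⟨fun h => ?_, fun h => le_iSup₂ (f := fun (r : ℕ)
    (_ : stalkIdeal I x ≤ IsLocalRing.maximalIdeal (X.presheaf.stalk x) ^ r) => (r : ℕ∞)) m h⟩
  rcases m with _ | m
  · simp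
  · by_contra hm
    have : ordAt I x ≤ m := iSup₂_le fun r hr => by
      by_contra hr'
      have : m + 1 ≤ r := by
        rw [not_le, Nat.cast_lt] at hr'
        exact hr'
      exact hm (hr.trans (Ideal.pow_le_pow_right this))
    have := h.trans this
    rw [Nat.cast_le] at this
    omega

theorem ordAt_anti {I J : X.IdealSheafData} (h : I ≤ J) (x : X) : ordAt J x ≤ ordAt I x :=
  iSup_mono fun _ => iSup_mono' fun hr => ⟨(stalkIdeal_mono h x).trans hr, le_rfl⟩

end Sheaf

/-! ### Orders at points in terms of derivative ideals. -/

section Points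

variable {k : Type u} [Field k] {X : Scheme.{u}}

theorem isAffineOpen_coe (U : X.affineOpens) : IsAffineOpen U.1 := U.2

/-- The prime ideal of a point in an affine open neighborhood. -/
abbrev pointIdeal (U : X.affineOpens) {x : X} (hx : x ∈ U.1) : Ideal Γ(X, U.1) :=
  ((isAffineOpen_coe U).primeIdealOf ⟨x, hx⟩).asIdeal

theorem mem_pointIdeal_iff (U : X.affineOpens) {x : X} (hx : x ∈ U.1) (g : Γ(X, U.1)) :
    g ∈ pointIdeal U hx ↔ x ∉ X.basicOpen g := by
  rw [pointIdeal, IsAffineOpen.primeIdealOf_eq_map_closedPoint, Scheme.mem_basicOpen _ _ _ hx]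
  exact Iff.rfl

theorem mem_support_iff_le_pointIdeal (Z : X.IdealSheafData) (U : X.affineOpens) {x : X}
    (hx : x ∈ U.1) : x ∈ Z.support ↔ Z.ideal U ≤ pointIdeal U hx := by
  rw [Scheme.IdealSheafData.mem_support_iff_of_mem hx, Scheme.mem_zeroLocus_iff]
  exact forall₂_congr fun g _ => (mem_pointIdeal_iff U hx g).symm

theorem exists_pointIdeal_eq (U : X.affineOpens) (q : Ideal Γ(X, U.1)) [hq : q.IsPrime] :
    ∃ (x : X) (hx : x ∈ U.1), pointIdeal U hx = q := by
  let y : Spec Γ(X, U.1) := (⟨q, hq⟩ : PrimeSpectrum Γ(X, U.1))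
  let e := (isAffineOpen_coe U).isoSpec
  refine ⟨(e.inv y).1, (e.inv y).2, ?_⟩
  have : e.hom (e.inv y) = y := by rw [← Scheme.Hom.comp_apply, Iso.inv_hom_id]; rfl
  exact congr_arg PrimeSpectrum.asIdeal this

theorem pointIdeal_le_of_specializes (U : X.affineOpens) {x y : X} (hx : x ∈ U.1) (h : y ⤳ x) :
    ∃ hy : y ∈ U.1, pointIdeal U hy ≤ pointIdeal U hx := by
  refine ⟨h.mem_open U.1.2 hx, fun g hg => ?_⟩
  rw [mem_pointIdeal_iff] at hg ⊢
  exact fun h' => hg (h.mem_open (X.basicOpen g).2 h')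

theorem eq_of_pointIdeal_eq (U : X.affineOpens) {x y : X} (hx : x ∈ U.1) (hy : y ∈ U.1)
    (h : pointIdeal U hx = pointIdeal U hy) : x = y := by
  have := congr_arg (isAffineOpen_coe U).fromSpec (PrimeSpectrum.ext h)
  rwa [IsAffineOpen.fromSpec_primeIdealOf, IsAffineOpen.fromSpec_primeIdealOf] at this

/-- The dictionary between orders and derivatives: the stalk is the localization at the prime of
`x`, and the algebraic criterion applies to it. -/
theorem succ_le_ordAt_iff [CharZero k] (f : X ⟶ Spec (.of k)) [Smooth f] (I : X.IdealSheafData)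
    (U : X.affineOpens) {x : X} (hx : x ∈ U.1) (n : ℕ) :
    ((n + 1 : ℕ) : ℕ∞) ≤ ordAt I x ↔ (iterDerivIdeal f n I).ideal U ≤ pointIdeal U hx := by
  let := sectionAlgebra f U.1
  have := smooth_sectionAlgebra f U
  let : Algebra Γ(X, U.1) (X.presheaf.stalk x) := (X.presheaf.germ U.1 x hx).hom.toAlgebra
  let : Algebra k (X.presheaf.stalk x) :=
    ((X.presheaf.germ U.1 x hx).hom.comp (constants f U.1)).toAlgebra
  have : IsScalarTower k Γ(X, U.1) (X.presheaf.stalk x) := .of_algebraMap_eq' rfl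
  have : IsLocalization.AtPrime (X.presheaf.stalk x) (pointIdeal U hx) :=
    U.2.isLocalization_stalk ⟨x, hx⟩
  rw [le_ordAt_iff, stalkIdeal_eq_map I U hx, ideal_iterDerivIdeal]
  exact map_le_maximalIdeal_pow_succ_iff k (B := X.presheaf.stalk x) (pointIdeal U hx) n _

theorem succ_le_ordAt_of_le_ordAt_pow [CharZero k] (f : X ⟶ Spec (.of k)) [Smooth f]
    {I : X.IdealSheafData} {x : X} {a m : ℕ}
    (h : ((a * m + 1 : ℕ) : ℕ∞) ≤ ordAt (I ^ a) x) : ((m + 1 : ℕ) : ℕ∞) ≤ ordAt I x := by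
  obtain ⟨U, hx⟩ := exists_affine_mem x
  let := sectionAlgebra f U.1
  have := smooth_sectionAlgebra f U
  let : Algebra Γ(X, U.1) (X.presheaf.stalk x) := (X.presheaf.germ U.1 x hx).hom.toAlgebra
  let : Algebra k (X.presheaf.stalk x) :=
    ((X.presheaf.germ U.1 x hx).hom.comp (constants f U.1)).toAlgebra
  have : IsScalarTower k Γ(X, U.1) (X.presheaf.stalk x) := .of_algebraMap_eq' rfl
  have : IsLocalization.AtPrime (X.presheaf.stalk x) (pointIdeal U hx) :=
    U.2.isLocalization_stalk ⟨x, hx⟩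
  rw [le_ordAt_iff] at h ⊢
  rw [stalkIdeal_pow] at h
  exact le_maximalIdeal_pow_succ_of_pow_le k (pointIdeal U hx) h

theorem le_ordAt_of_mul_le_ordAt_pow [CharZero k] (f : X ⟶ Spec (.of k)) [Smooth f]
    {I : X.IdealSheafData} {x : X} {a m : ℕ} (ha : a ≠ 0)
    (h : ((a * m : ℕ) : ℕ∞) ≤ ordAt (I ^ a) x) : (m : ℕ∞) ≤ ordAt I x := by
  rcases m with _ | m
  · simp
  · refine succ_le_ordAt_of_le_ordAt_pow f (le_trans (Nat.cast_le.2 ?_) h)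
    have := Nat.pos_of_ne_zero ha
    rw [mul_add, mul_one]
    omega

theorem formallySmooth_quotient_of_smooth (f : X ⟶ Spec (.of k)) (Z : X.IdealSheafData)
    [Smooth (Z.subschemeι ≫ f)] (U : X.affineOpens) : letI := sectionAlgebra f U.1
    Algebra.FormallySmooth k (Γ(X, U.1) ⧸ Z.ideal U) := by
  let := sectionAlgebra f U.1
  have h := smooth_constants (Z.subschemeι ≫ f) ⟨_, U.2.preimage Z.subschemeι⟩
  have h2 := (RingHom.Smooth.respectsIso).1 _
    (Z.subschemeObjIso U).commRingCatIsoToRingEquiv h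
  have h3 : (Z.subschemeObjIso U).commRingCatIsoToRingEquiv.toRingHom.comp
      (constants (Z.subschemeι ≫ f) (Z.subschemeι ⁻¹ᵁ U.1)) =
      algebraMap k (Γ(X, U.1) ⧸ Z.ideal U) := by
    rw [← appLE_comp_constants Z.subschemeι f (le_refl _), ← RingHom.comp_assoc]
    congr 1
    have h4 : Z.subschemeι.appLE U.1 (Z.subschemeι ⁻¹ᵁ U.1) le_rfl ≫ (Z.subschemeObjIso U).hom =
        CommRingCat.ofHom (Ideal.Quotient.mk (Z.ideal U)) := by
      rw [← Scheme.Hom.app_eq_appLE, Scheme.IdealSheafData.subschemeι_app, Category.assoc,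
        Iso.inv_hom_id, Category.comp_id]
    exact congr_arg CommRingCat.Hom.hom h4
  have h5 : (algebraMap k (Γ(X, U.1) ⧸ Z.ideal U)).Smooth := h3 ▸ h2
  rw [RingHom.smooth_algebraMap] at h5
  infer_instance

/-- An ideal that vanishes to order `m` at the generic points of a smooth closed subscheme is
contained in the `m`-th power of its ideal. -/
theorem le_pow_of_ordAlongGE [CharZero k] (f : X ⟶ Spec (.of k)) [Smooth f]
    {Z I : X.IdealSheafData} (hZ : Smooth (Z.subschemeι ≫ f)) {m : ℕ} (h : OrdAlongGE Z I m) :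
    I ≤ Z ^ m := by
  intro U
  rcases m with _ | m
  · simp
  let := sectionAlgebra f U.1
  have := smooth_sectionAlgebra f U
  have := formallySmooth_quotient_of_smooth f Z U
  rw [Scheme.IdealSheafData.ideal_pow, Pi.pow_apply]
  refine le_pow_of_iterate_diffIdeal_le_minimalPrimes (k := k) _ _ _ fun q hq => ?_
  have := hq.1.1
  -- Minimal primes over the ideal of `Z` are the generic points of `Z` lying in `U`, where the
  -- order hypothesis is available.
  obtain ⟨z, hz, rfl⟩ := exists_pointIdeal_eq U q
  rw [← ideal_iterDerivIdeal]
  refine (succ_le_ordAt_iff f I U hz m).1 (h z ⟨?_, fun y hy hyz => ?_⟩)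
  · exact (mem_support_iff_le_pointIdeal Z U hz).2 hq.1.2
  · obtain ⟨hyU, hle⟩ := pointIdeal_le_of_specializes U hz hyz
    have hy' := (mem_support_iff_le_pointIdeal Z U hyU).1 hy
    exact eq_of_pointIdeal_eq U hyU hz (hle.antisymm (hq.2 ⟨inferInstance, hy'⟩ hle))

end Points

/-! ### Inverse image ideal sheaves in affine charts. -/

section Comap

variable {X X' : Scheme.{u}}

theorem le_of_forall_exists_affine {I J : X.IdealSheafData}
    (h : ∀ x : X, ∃ U : X.affineOpens, x ∈ U.1 ∧ I.ideal U ≤ J.ideal U) : I ≤ J := by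
  choose U hU h using h
  refine Scheme.IdealSheafData.le_of_iSup_eq_top U ?_ h
  exact top_le_iff.1 fun x _ => Opens.mem_iSup.2 ⟨x, hU x⟩

/-- The ideal of a ring corresponding to an ideal sheaf on its spectrum. -/
def specIdeal {R : CommRingCat.{u}} (J : (Spec R).IdealSheafData) : Ideal R :=
  (J.ideal ⟨⊤, isAffineOpen_top _⟩).comap (Scheme.ΓSpecIso R).inv.hom

theorem map_specIdeal {R : CommRingCat.{u}} (J : (Spec R).IdealSheafData) :
    (specIdeal J).map (Scheme.ΓSpecIso R).inv.hom = J.ideal ⟨⊤, isAffineOpen_top _⟩ :=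
  Ideal.map_comap_of_surjective _
    (Scheme.ΓSpecIso R).symm.commRingCatIsoToRingEquiv.surjective _

theorem specIdeal_le_iff {R : CommRingCat.{u}} {J K : (Spec R).IdealSheafData} :
    specIdeal J ≤ specIdeal K ↔ J ≤ K := by
  refine ⟨fun h => Scheme.IdealSheafData.le_of_isAffine ?_, fun h => Ideal.comap_mono (h _)⟩
  rw [← map_specIdeal, ← map_specIdeal]
  exact Ideal.map_mono h

theorem exists_specIdeal_eq {R : CommRingCat.{u}} (a : Ideal R) :
    ∃ J : (Spec R).IdealSheafData, specIdeal J = a := by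
  refine ⟨Scheme.IdealSheafData.ofIdealTop (a.map (Scheme.ΓSpecIso R).inv.hom), ?_⟩
  have h : (Scheme.IdealSheafData.ofIdealTop (a.map (Scheme.ΓSpecIso R).inv.hom)).ideal
      ⟨⊤, isAffineOpen_top _⟩ = a.map (Scheme.ΓSpecIso R).inv.hom := by
    exact (Scheme.IdealSheafData.equivOfIsAffine (X := Spec R)).apply_symm_apply _
  rw [specIdeal, h]
  exact Ideal.comap_map_of_bijective _
    (Scheme.ΓSpecIso R).symm.commRingCatIsoToRingEquiv.bijective

theorem specIdeal_map {R S : CommRingCat.{u}} (φ : R ⟶ S) (K : (Spec S).IdealSheafData) :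
    specIdeal (K.map (Spec.map φ)) = (specIdeal K).comap φ.hom := by
  rw [specIdeal, Scheme.IdealSheafData.ideal_map_of_isAffineHom, specIdeal, Ideal.comap_comap,
    Ideal.comap_comap, ← CommRingCat.hom_comp, ← CommRingCat.hom_comp]
  congr 2
  exact (Scheme.ΓSpecIso_inv_naturality φ).symm

/-- Both sides are left adjoint to pullback of ideals along the ring map, so they have the same
upper bounds. -/
theorem specIdeal_comap {R S : CommRingCat.{u}} (φ : R ⟶ S) (J : (Spec R).IdealSheafData) :
    specIdeal (J.comap (Spec.map φ)) = (specIdeal J).map φ.hom := by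
  refine eq_of_forall_ge_iff fun a => ?_
  obtain ⟨K, rfl⟩ := exists_specIdeal_eq a
  rw [specIdeal_le_iff, Ideal.map_le_iff_le_comap, ← specIdeal_map, specIdeal_le_iff,
    Scheme.IdealSheafData.le_map_iff_comap_le]

theorem specIdeal_comap_fromSpec (I : X.IdealSheafData) (U : X.affineOpens) :
    specIdeal (I.comap (isAffineOpen_coe U).fromSpec) = I.ideal U := by
  let g := (isAffineOpen_coe U).fromSpec
  let W : X.affineOpens := ⟨g ''ᵁ ⊤, (isAffineOpen_top _).image_of_isOpenImmersion g⟩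
  have hW : W.1 = U.1 := by
    ext1
    simp [W, g]
  have hWU : W ≤ U := hW.le
  have h1 : (I.comap g).ideal ⟨⊤, isAffineOpen_top _⟩ =
      (I.ideal W).comap (g.appIso ⊤).inv.hom :=
    Scheme.IdealSheafData.ideal_comap_of_isOpenImmersion I g ⟨⊤, isAffineOpen_top _⟩
  have h2 : (I.ideal W).comap (g.appIso ⊤).inv.hom = (I.ideal W).map (g.appIso ⊤).hom.hom :=
    (Ideal.comap_symm (g.appIso ⊤).commRingCatIsoToRingEquiv)
  have h3 : ∀ J : Ideal Γ(Spec Γ(X, U.1), ⊤), J.comap (Scheme.ΓSpecIso Γ(X, U.1)).inv.hom =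
      J.map (Scheme.ΓSpecIso Γ(X, U.1)).hom.hom := fun J =>
    (Ideal.comap_symm (Scheme.ΓSpecIso Γ(X, U.1)).commRingCatIsoToRingEquiv)
  rw [specIdeal, h1, h2, h3, ← I.map_ideal hWU, Ideal.map_map, Ideal.map_map,
    ← CommRingCat.hom_comp, ← CommRingCat.hom_comp]
  have h4 : X.presheaf.map (homOfLE (X := X.Opens) hWU).op ≫ (g.appIso ⊤).hom =
      (Scheme.ΓSpecIso Γ(X, U.1)).inv := by
    have h5 : (⊤ : (Spec Γ(X, U.1)).Opens) ≤ g ⁻¹ᵁ U.1 :=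
      (isAffineOpen_coe U).fromSpec_preimage_self.ge
    have h6 : g.appLE U.1 ⊤ h5 = (Scheme.ΓSpecIso Γ(X, U.1)).inv := by
      rw [Scheme.Hom.appLE, (isAffineOpen_coe U).fromSpec_app_self, Category.assoc,
        ← Functor.map_comp]
      exact (congr_arg _ ((Spec Γ(X, U.1)).presheaf.map_id _)).trans (Category.comp_id _)
    rw [Scheme.Hom.appIso_hom', ← h6]
    exact Scheme.Hom.map_appLE g _ (homOfLE (X := X.Opens) hWU).op
  have h7 : X.presheaf.map (homOfLE (X := X.Opens) hWU).op ≫ (g.appIso ⊤).hom ≫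
      (Scheme.ΓSpecIso Γ(X, U.1)).hom = 𝟙 _ := by
    rw [← Category.assoc, h4, Iso.inv_hom_id]
  refine (congr_arg (fun φ => Ideal.map (CommRingCat.Hom.hom φ) (I.ideal U)) h7).trans ?_
  exact Ideal.map_id _

theorem ideal_comap (π : X' ⟶ X) (I : X.IdealSheafData) {U : X.affineOpens} {V : X'.affineOpens}
    (h : V.1 ≤ π ⁻¹ᵁ U.1) : (I.comap π).ideal V = (I.ideal U).map (π.appLE U.1 V.1 h).hom := by
  rw [← specIdeal_comap_fromSpec, ← Scheme.IdealSheafData.comap_comp,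
    ← IsAffineOpen.SpecMap_appLE_fromSpec π (isAffineOpen_coe U) (isAffineOpen_coe V) h,
    Scheme.IdealSheafData.comap_comp, specIdeal_comap, specIdeal_comap_fromSpec]

theorem exists_affine_le_preimage (π : X' ⟶ X) {x : X'} {O : X'.Opens} (hx : x ∈ O) :
    ∃ (U : X.affineOpens) (V : X'.affineOpens), x ∈ V.1 ∧ V.1 ≤ O ∧ V.1 ≤ π ⁻¹ᵁ U.1 := by
  obtain ⟨U, hU⟩ := exists_affine_mem (π x)
  obtain ⟨V, hV, hxV, hVU⟩ := exists_isAffineOpen_mem_and_subset (U := O ⊓ π ⁻¹ᵁ U.1) (x := x)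
    ⟨hx, hU⟩
  exact ⟨U, ⟨V, hV⟩, hxV, fun y hy => (hVU hy).1, fun y hy => (hVU hy).2⟩

theorem eq_of_forall_exists_affine {I J : X.IdealSheafData}
    (h : ∀ x : X, ∃ U : X.affineOpens, x ∈ U.1 ∧ I.ideal U = J.ideal U) : I = J :=
  le_antisymm
    (le_of_forall_exists_affine fun x => (h x).imp fun _ h => ⟨h.1, h.2.le⟩)
    (le_of_forall_exists_affine fun x => (h x).imp fun _ h => ⟨h.1, h.2.ge⟩)

theorem comap_mul (π : X' ⟶ X) (I J : X.IdealSheafData) :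
    (I * J).comap π = I.comap π * J.comap π := by
  refine eq_of_forall_exists_affine fun x => ?_
  obtain ⟨U, V, hx, -, hV⟩ := exists_affine_le_preimage π (O := ⊤) (x := x) trivial
  refine ⟨V, hx, ?_⟩
  simp only [Scheme.IdealSheafData.ideal_mul, Pi.mul_apply, ideal_comap π _ hV, Ideal.map_mul]

theorem comap_pow (π : X' ⟶ X) (I : X.IdealSheafData) (n : ℕ) :
    (I ^ n).comap π = I.comap π ^ n := by
  induction n with
  | zero => simp
  | succ n ih => rw [pow_succ, pow_succ, comap_mul, ih]

theorem comap_prod (π : X' ⟶ X) {ι : Type*} (s : Finset ι) (I : ι → X.IdealSheafData) :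
    (∏ i ∈ s, I i).comap π = ∏ i ∈ s, (I i).comap π := by
  classical
  induction s using Finset.induction_on with
  | empty => simp
  | insert a s ha ih => rw [Finset.prod_insert ha, Finset.prod_insert ha, comap_mul, ih]

theorem comap_iSup (π : X' ⟶ X) {ι : Sort*} (I : ι → X.IdealSheafData) :
    (⨆ i, I i).comap π = ⨆ i, (I i).comap π :=
  (Scheme.IdealSheafData.map_gc π).l_iSup

end Comap

/-! ### Lifting derivations to a blow-up through dual numbers. -/

section DualNumbers

variable {A B : Type*} [CommRing A] [CommRing B]

/-- The ring homomorphism `a ↦ φ a + ε e φ (δ a)` to the dual numbers. -/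
def dualNumberHom {k : Type*} [Field k] [Algebra k A] (φ : A →+* B) (e : B)
    (δ : Derivation k A A) : A →+* DualNumber B where
  toFun a := TrivSqZeroExt.inl (φ a) + TrivSqZeroExt.inr (e * φ (δ a))
  map_one' := by simp
  map_mul' a b := by
    ext
    · simp
    · simp [Derivation.leibniz]; ring
  map_zero' := by simp
  map_add' a b := by
    ext
    · simp
    · simp [mul_add]

/-- The factor `e` in the infinitesimal part makes every image divisible by `e`. Conversely the
image ideal contains some `e * (1 + ε t)`, and `1 + ε t` is a unit with inverse `1 - ε t`. -/
theorem map_dualNumberHom {k : Type*} [Field k] [Algebra k A] (φ : A →+* B) (e : B)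
    (δ : Derivation k A A) {I : Ideal A} (h : I.map φ = Ideal.span {e}) :
    I.map (dualNumberHom φ e δ) = Ideal.span {(TrivSqZeroExt.inl e : DualNumber B)} := by
  apply le_antisymm
  · refine Ideal.map_le_iff_le_comap.2 fun z hz => ?_
    have h1 : φ z ∈ Ideal.span {e} := h ▸ Ideal.mem_map_of_mem φ hz
    obtain ⟨w, hw⟩ := Ideal.mem_span_singleton'.1 h1
    refine Ideal.mem_span_singleton'.2
      ⟨TrivSqZeroExt.inl w + TrivSqZeroExt.inr (φ (δ z)), ?_⟩
    ext
    · simp [dualNumberHom, hw]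
    · simp [dualNumberHom, mul_comm]
  · have h1 : ∀ w ∈ I.map φ, ∃ t : B,
        (TrivSqZeroExt.inl w + TrivSqZeroExt.inr (e * t) : DualNumber B) ∈
          I.map (dualNumberHom φ e δ) := fun w hw => by
      induction hw using Submodule.span_induction with
      | mem x hx =>
        obtain ⟨z, hz, rfl⟩ := hx
        exact ⟨φ (δ z), Ideal.mem_map_of_mem (dualNumberHom φ e δ) hz⟩
      | zero => exact ⟨0, by simp⟩
      | add x y _ _ hx hy =>
        obtain ⟨s, hs⟩ := hx
        obtain ⟨t, ht⟩ := hy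
        refine ⟨s + t, ?_⟩
        convert add_mem hs ht using 1
        ext <;> simp [mul_add]
      | smul a x _ hx =>
        obtain ⟨t, ht⟩ := hx
        refine ⟨a * t, ?_⟩
        convert Ideal.mul_mem_left _ (TrivSqZeroExt.inl a : DualNumber B) ht using 1
        ext
        · simp
        · simp; ring
    obtain ⟨t, ht⟩ := h1 e (h ▸ Ideal.mem_span_singleton_self e)
    refine (Ideal.span_singleton_le_iff_mem _).2 ?_
    convert Ideal.mul_mem_left _ (1 - TrivSqZeroExt.inr t : DualNumber B) ht using 1
    ext
    · simp
    · simp; ring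

theorem inl_mem_nonZeroDivisors {e : B} (he : e ∈ nonZeroDivisors B) :
    (TrivSqZeroExt.inl e : DualNumber B) ∈ nonZeroDivisors (DualNumber B) := by
  rw [mem_nonZeroDivisors_iff_right] at he ⊢
  intro x hx
  have h1 := congr_arg TrivSqZeroExt.fst hx
  have h2 := congr_arg TrivSqZeroExt.snd hx
  ext
  · exact he _ (by simpa using h1)
  · exact he _ (by simpa [mul_comm] using h2)

end DualNumbers

section Lift

theorem isInvertibleIdeal_of_specIdeal {R : CommRingCat.{u}} {J : (Spec R).IdealSheafData} {g : R}
    (hg : g ∈ nonZeroDivisors R) (h : specIdeal J = Ideal.span {g}) : IsInvertibleIdeal J := by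
  intro x
  refine ⟨⟨⊤, isAffineOpen_top _⟩, trivial, (Scheme.ΓSpecIso R).inv.hom g, ?_, ?_⟩
  · exact (MulEquivClass.map_nonZeroDivisors
      (Scheme.ΓSpecIso R).symm.commRingCatIsoToRingEquiv).le (Submonoid.mem_map_of_mem _ hg)
  · rw [← map_specIdeal, h, Ideal.map_span, Set.image_singleton]

/-- Elements with zero first component square to zero, so they lie in every prime. -/
theorem surjective_specMap_fst (B : CommRingCat.{u}) :
    Function.Surjective (Spec.map (CommRingCat.ofHom
      (TrivSqZeroExt.fstHom B B B).toRingHom : CommRingCat.of (DualNumber B) ⟶ B)) := by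
  intro q
  have h : Set.range (PrimeSpectrum.comap (TrivSqZeroExt.fstHom B B B).toRingHom) =
      PrimeSpectrum.zeroLocus (RingHom.ker (TrivSqZeroExt.fstHom B B B).toRingHom) :=
    range_comap_of_surjective _ _ TrivSqZeroExt.fst_surjective
  have : (q : PrimeSpectrum (DualNumber B)) ∈
      Set.range (PrimeSpectrum.comap (TrivSqZeroExt.fstHom B B B).toRingHom) := by
    rw [h]
    intro x hx
    have hx' : x.fst = 0 := hx
    have h2 : x * x = 0 := by ext <;> simp [hx']
    have hq := q.isPrime
    exact (hq.mem_or_mem (h2 ▸ q.asIdeal.zero_mem : x * x ∈ q.asIdeal)).elim id id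
  exact this

variable {k : Type u} [Field k] {X X' : Scheme.{u}}

/-- A derivation multiplied by an equation of the exceptional divisor lifts to the blow-up. -/
theorem exists_derivation_lift {f : X ⟶ Spec (.of k)} {π : X' ⟶ X} {Z : X.IdealSheafData}
    (hπ : IsBlowUp π Z) {U : X.affineOpens} {V : X'.affineOpens} (hV : V.1 ≤ π ⁻¹ᵁ U.1)
    {e : Γ(X', V.1)} (he : e ∈ nonZeroDivisors Γ(X', V.1))
    (heZ : (Z.comap π).ideal V = Ideal.span {e}) (δ : SectionDerivation f U.1) :
    ∃ Δ : SectionDerivation (π ≫ f) V.1, ∀ a, Δ ((π.appLE U.1 V.1 hV).hom a) =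
      e * (π.appLE U.1 V.1 hV).hom (δ a) := by
  let := sectionAlgebra f U.1
  let := sectionAlgebra (π ≫ f) V.1
  let φ₀ := π.appLE U.1 V.1 hV
  let S : CommRingCat.{u} := .of (DualNumber Γ(X', V.1))
  let φ : Γ(X, U.1) ⟶ S := CommRingCat.ofHom (dualNumberHom φ₀.hom e δ)
  let p : S ⟶ Γ(X', V.1) := CommRingCat.ofHom (TrivSqZeroExt.fstHom Γ(X', V.1) Γ(X', V.1) Γ(X', V.1)).toRingHom
  have hφp : φ ≫ p = φ₀ := by
    ext a
    change (dualNumberHom φ₀.hom e δ a).fst = _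
    simp [dualNumberHom]
  have hZ : (Z.ideal U).map φ₀.hom = Ideal.span {e} := by rw [← heZ, ideal_comap π Z hV]
  let jU := (isAffineOpen_coe U).fromSpec
  let jV := (isAffineOpen_coe V).fromSpec
  have hj : Spec.map φ₀ ≫ jU = jV ≫ π :=
    IsAffineOpen.SpecMap_appLE_fromSpec π (isAffineOpen_coe U) (isAffineOpen_coe V) hV
  -- The derivation `e * δ` is a first-order deformation of `V ⟶ U`. The center pulls back to the
  -- invertible ideal `(e)`, so the deformation factors through the blow-up.
  have h1 : IsInvertibleIdeal (Z.comap (Spec.map φ ≫ jU)) := by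
    refine isInvertibleIdeal_of_specIdeal (R := S) (inl_mem_nonZeroDivisors he) ?_
    rw [Scheme.IdealSheafData.comap_comp, specIdeal_comap, specIdeal_comap_fromSpec]
    exact map_dualNumberHom _ _ _ hZ
  have h2 : IsInvertibleIdeal (Z.comap (jV ≫ π)) := by
    refine isInvertibleIdeal_of_specIdeal he ?_
    rw [Scheme.IdealSheafData.comap_comp, specIdeal_comap_fromSpec, heZ]
  obtain ⟨h, hh, -⟩ := hπ.existsUnique_lift _ _ h1
  have h3 : Spec.map p ≫ h = jV := by
    refine (hπ.existsUnique_lift _ _ h2).unique ?_ rfl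
    rw [Category.assoc, hh, ← Category.assoc, ← Spec.map_comp, hφp, hj]
  have h4 : Set.range h ⊆ Set.range jV := by
    rintro _ ⟨y, rfl⟩
    obtain ⟨y', rfl⟩ := surjective_specMap_fst Γ(X', V.1) y
    exact ⟨y', by rw [← h3]; rfl⟩
  let l := IsOpenImmersion.lift jV h h4
  have hl : l ≫ jV = h := IsOpenImmersion.lift_fac _ _ _
  obtain ⟨ψ, hψ⟩ : ∃ ψ : Γ(X', V.1) ⟶ S, Spec.map ψ = l := ⟨Spec.preimage l, Spec.map_preimage l⟩
  have h5 : ψ ≫ p = 𝟙 _ := by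
    apply Spec.map_injective
    rw [← cancel_mono jV, Spec.map_comp, Category.assoc, hψ, hl, h3, Spec.map_id,
      Category.id_comp]
  have h6 : φ₀ ≫ ψ = φ := by
    apply Spec.map_injective
    rw [← cancel_mono jU, Spec.map_comp, Category.assoc, hj, hψ, ← Category.assoc, hl, hh]
  have h5' : ∀ a, (ψ.hom a).fst = a := fun a => congr_arg (fun χ => χ.hom a) h5
  have h6' : ∀ a, (ψ.hom (φ₀.hom a)).snd = e * φ₀.hom (δ a) := fun a => by
    have : ψ.hom (φ₀.hom a) = dualNumberHom φ₀.hom e δ a := congr_arg (fun χ => χ.hom a) h6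
    rw [this]
    simp [dualNumberHom]
  have h7 : ∀ a b, (ψ.hom (a * b)).snd = a * (ψ.hom b).snd + b * (ψ.hom a).snd := fun a b => by
    rw [map_mul]
    have := TrivSqZeroExt.snd_mul (ψ.hom a) (ψ.hom b)
    rw [h5', h5'] at this
    exact this.trans (congr_arg (a * (ψ.hom b).snd + ·) (mul_comm _ _))
  have h8 : ∀ c : k, (ψ.hom (algebraMap k Γ(X', V.1) c)).snd = 0 := fun c => by
    have : algebraMap k Γ(X', V.1) c = φ₀.hom (algebraMap k Γ(X, U.1) c) :=
      (RingHom.congr_fun (appLE_comp_constants π f hV) c).symm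
    rw [this, h6', Derivation.map_algebraMap, map_zero, mul_zero]
  let D : Γ(X', V.1) →ₗ[k] Γ(X', V.1) :=
    { toFun := fun a => (ψ.hom a).snd
      map_add' := fun a b => by rw [map_add]; rfl
      map_smul' := fun c a => by
        rw [Algebra.smul_def, h7, h8, mul_zero, add_zero, RingHom.id_apply, Algebra.smul_def] }
  exact ⟨Derivation.mk' D h7, h6'⟩

end Lift

/-! ### Birational transforms and derivatives. -/

section Transform

variable {k : Type u} [Field k] {X X' : Scheme.{u}}

theorem exists_principal_chart (π : X' ⟶ X) {J : X'.IdealSheafData} (hJ : IsInvertibleIdeal J)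
    (x : X') : ∃ (U : X.affineOpens) (V : X'.affineOpens) (e : Γ(X', V.1)), x ∈ V.1 ∧
      V.1 ≤ π ⁻¹ᵁ U.1 ∧ e ∈ nonZeroDivisors Γ(X', V.1) ∧ J.ideal V = Ideal.span {e} := by
  obtain ⟨V, hxV, e, he, hJ⟩ := hJ x
  obtain ⟨U, hU⟩ := exists_affine_mem (π x)
  obtain ⟨r, hr, hxr⟩ := (isAffineOpen_coe V).exists_basicOpen_le (V := π ⁻¹ᵁ U.1) ⟨x, hU⟩ hxV
  let res := (X'.presheaf.map (homOfLE (X'.basicOpen_le r)).op).hom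
  refine ⟨U, X'.affineBasicOpen r, res e, hxr, hr, ?_, ?_⟩
  · let : Algebra Γ(X', V.1) Γ(X', X'.basicOpen r) := res.toAlgebra
    have : IsLocalization.Away r Γ(X', X'.basicOpen r) :=
      (isAffineOpen_coe V).isLocalization_basicOpen r
    exact IsLocalization.map_nonZeroDivisors_le (.powers r) Γ(X', X'.basicOpen r)
      (Submonoid.mem_map_of_mem (algebraMap Γ(X', V.1) Γ(X', X'.basicOpen r)) he)
  · rw [← J.map_ideal_basicOpen, hJ, Ideal.map_span, Set.image_singleton]
    rfl

theorem le_of_pow_mul_le_pow_mul {J K L : X.IdealSheafData} (hJ : IsInvertibleIdeal J) {n : ℕ}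
    (h : J ^ n * K ≤ J ^ n * L) : K ≤ L := by
  refine le_of_forall_exists_affine fun x => ?_
  obtain ⟨U, hx, e, he, hJe⟩ := hJ x
  refine ⟨U, hx, fun a ha => ?_⟩
  have h1 := h U
  simp only [Scheme.IdealSheafData.ideal_mul, Scheme.IdealSheafData.ideal_pow, Pi.mul_apply,
    Pi.pow_apply, hJe, Ideal.span_singleton_pow] at h1
  obtain ⟨b, hb, hab⟩ := Ideal.mem_span_singleton_mul.1
    (h1 (Ideal.mul_mem_mul (Ideal.mem_span_singleton_self _) ha))
  rw [mul_cancel_left_mem_nonZeroDivisors (pow_mem he n)] at hab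
  rwa [← hab]

/-- Birational transforms commute with derivatives up to inclusion. -/
theorem comap_derivIdeal_le (f : X ⟶ Spec (.of k)) [Smooth f] {π : X' ⟶ X}
    {Z : X.IdealSheafData} (hπ : IsBlowUp π Z) [Smooth (π ≫ f)] {K : X.IdealSheafData}
    {K' : X'.IdealSheafData} {m : ℕ} (h : K.comap π ≤ (Z.comap π) ^ (m + 1) * K') :
    (derivIdeal f K).comap π ≤ (Z.comap π) ^ m * derivIdeal (π ≫ f) K' := by
  refine le_of_forall_exists_affine fun x => ?_
  obtain ⟨U, V, e, hx, hV, he, heZ⟩ := exists_principal_chart π hπ.isInvertibleIdeal x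
  refine ⟨V, hx, ?_⟩
  let := sectionAlgebra f U.1
  let := sectionAlgebra (π ≫ f) V.1
  let φ := (π.appLE U.1 V.1 hV).hom
  have h1 := h V
  simp only [Scheme.IdealSheafData.ideal_mul, Scheme.IdealSheafData.ideal_pow, Pi.mul_apply,
    Pi.pow_apply, heZ, Ideal.span_singleton_pow, ideal_comap π _ hV] at h1 ⊢
  rw [ideal_derivIdeal, Ideal.map_le_iff_le_comap]
  have h2 : ∀ g ∈ K.ideal U, ∃ g' ∈ K'.ideal V, e ^ (m + 1) * g' = φ g := fun g hg =>
    Ideal.mem_span_singleton_mul.1 (h1 (Ideal.mem_map_of_mem _ hg))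
  refine diffIdeal_le (fun g hg => ?_) fun δ g hg => ?_
  · obtain ⟨g', hg', hgg'⟩ := h2 g hg
    refine Ideal.mem_span_singleton_mul.2
      ⟨e * g', Ideal.mul_mem_left _ _ (le_derivIdeal _ _ _ hg'), ?_⟩
    rw [← mul_assoc, ← pow_succ]
    exact hgg'
  · obtain ⟨g', hg', hgg'⟩ := h2 g hg
    obtain ⟨Δ, hΔ⟩ := exists_derivation_lift hπ hV he heZ δ
    have h3 : (Z.ideal U).map φ = Ideal.span {e} := by rw [← heZ, ideal_comap π Z hV]
    -- The divisor is preserved by `Δ`: `e` is a combination of pulled back equations of the center,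
    -- on which `Δ` takes multiples of `e`.
    have h4 : Δ e ∈ Ideal.span {e} := by
      have h5 : e ∈ Ideal.span (φ '' (Z.ideal U : Set Γ(X, U.1))) :=
        h3.ge (Ideal.mem_span_singleton_self e)
      refine derivation_mem_of_span Δ ?_ ?_ h5
      · rintro _ ⟨z, hz, rfl⟩
        exact h3.le (Ideal.mem_map_of_mem _ hz)
      · rintro _ ⟨z, hz, rfl⟩
        rw [hΔ]
        exact Ideal.mul_mem_right _ _ (Ideal.mem_span_singleton_self e)
    obtain ⟨t, ht⟩ := Ideal.mem_span_singleton'.1 h4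
    -- With `φ g = e ^ (m + 1) * g'` and `Δ e = t * e`, expand `Δ (φ g) = e * φ (δ g)` and cancel
    -- one `e`.
    refine Ideal.mem_span_singleton_mul.2
      ⟨Δ g' + (m + 1 : ℕ) * t * g', add_mem (derivation_mem_derivIdeal _ Δ hg')
        (Ideal.mul_mem_left _ _ (le_derivIdeal _ _ _ hg')), ?_⟩
    rw [← mul_cancel_left_mem_nonZeroDivisors he]
    refine Eq.trans ?_ (hΔ g)
    change _ = Δ (φ g)
    rw [← hgg', Derivation.leibniz, Derivation.leibniz_pow, ← ht]
    simp only [smul_eq_mul, nsmul_eq_mul, Nat.add_sub_cancel]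
    ring

/-- Finite generation of `K` allows one power of `r` to clear the denominators for all generators.
-/
theorem map_colon_of_isLocalization_away {A B : Type*} [CommRing A] [IsNoetherianRing A]
    [CommRing B] [Algebra A B] (r : A) [IsLocalization.Away r B] (J K : Ideal A) :
    (J.colon K : Ideal A).map (algebraMap A B) =
      (J.map (algebraMap A B)).colon (K.map (algebraMap A B)) := by
  apply le_antisymm
  · refine Ideal.map_le_iff_le_comap.2 fun a ha => ?_
    rw [Ideal.mem_comap, Ideal.map.eq_1 _ K, Ideal.colon_span, Submodule.mem_colon]
    rintro _ ⟨b, hb, rfl⟩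
    rw [smul_eq_mul, ← map_mul]
    exact Ideal.mem_map_of_mem _ (Submodule.mem_colon.1 ha b hb)
  · intro x hx
    obtain ⟨⟨a, ⟨_, n, rfl⟩⟩, hax⟩ := IsLocalization.surj (.powers r) x
    obtain ⟨s, rfl⟩ := (isNoetherianRing_iff_ideal_fg _).1 ‹_› K
    have h1 : ∀ b ∈ s, ∃ N, r ^ N * (a * b) ∈ J := fun b hb => by
      have h2 : x * algebraMap A B b ∈ J.map (algebraMap A B) :=
        Submodule.mem_colon.1 hx _ (Ideal.mem_map_of_mem _ (Ideal.subset_span hb))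
      have h3 : algebraMap A B (a * b) ∈ J.map (algebraMap A B) := by
        rw [map_mul, ← hax, mul_right_comm]
        exact Ideal.mul_mem_right _ _ h2
      obtain ⟨_, ⟨N, rfl⟩, h4⟩ :=
        (IsLocalization.algebraMap_mem_map_algebraMap_iff (.powers r) _ _ _).1 h3
      exact ⟨N, h4⟩
    choose! N hN using h1
    have h2 : r ^ (s.sup N) * a ∈ J.colon (Ideal.span (s : Set A)) := by
      rw [Ideal.colon_span, Submodule.mem_colon]
      intro b hb
      obtain ⟨d, hd⟩ := Nat.exists_eq_add_of_le (Finset.le_sup (f := N) hb)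
      rw [hd, pow_add, smul_eq_mul]
      have := Ideal.mul_mem_left _ (r ^ d) (hN b hb)
      convert this using 1
      ring
    have h3 := Ideal.mem_map_of_mem (algebraMap A B) h2
    rw [map_mul, ← hax] at h3
    have hu : ∀ n, IsUnit (algebraMap A B (r ^ n)) := fun n =>
      IsLocalization.map_units (M := .powers r) _ ⟨r ^ n, n, rfl⟩
    rw [Ideal.unit_mul_mem_iff_mem _ (hu _), mul_comm] at h3
    exact (Ideal.unit_mul_mem_iff_mem _ (hu n)).1 h3

/-- The colon ideal sheaf on a smooth scheme. -/
def colonSheaf (f : X ⟶ Spec (.of k)) [Smooth f] (J K : X.IdealSheafData) :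
    X.IdealSheafData where
  ideal U := (J.ideal U).colon (K.ideal U)
  map_ideal_basicOpen U r := by
    let := sectionAlgebra f U.1
    have := smooth_sectionAlgebra f U
    have : IsNoetherianRing Γ(X, U.1) := Algebra.FiniteType.isNoetherianRing k _
    let : Algebra Γ(X, U.1) Γ(X, X.basicOpen r) :=
      (X.presheaf.map (homOfLE <| X.basicOpen_le r).op).hom.toAlgebra
    have : IsLocalization.Away r Γ(X, X.basicOpen r) := U.2.isLocalization_basicOpen r
    rw [← J.map_ideal_basicOpen U r, ← K.map_ideal_basicOpen U r]
    exact map_colon_of_isLocalization_away (B := Γ(X, X.basicOpen r)) r _ _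

theorem mul_colonSheaf_le (f : X ⟶ Spec (.of k)) [Smooth f] (J K : X.IdealSheafData) :
    K * colonSheaf f J K ≤ J := by
  intro U
  refine Ideal.mul_le.2 fun a ha b hb => ?_
  rw [mul_comm]
  exact Submodule.mem_colon.1 hb a ha

theorem le_mul_colonSheaf (f : X ⟶ Spec (.of k)) [Smooth f] {J K : X.IdealSheafData}
    (hK : IsInvertibleIdeal K) {n : ℕ} (h : J ≤ K ^ n) : J ≤ K ^ n * colonSheaf f J (K ^ n) := by
  refine le_of_forall_exists_affine fun x => ?_
  obtain ⟨U, hx, e, he, hKe⟩ := hK x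
  refine ⟨U, hx, fun a ha => ?_⟩
  have h2 : (K ^ n).ideal U = Ideal.span {e ^ n} := by
    rw [Scheme.IdealSheafData.ideal_pow, Pi.pow_apply, hKe, Ideal.span_singleton_pow]
  have h1 := h U ha
  rw [h2] at h1
  obtain ⟨b, hb⟩ := Ideal.mem_span_singleton'.1 h1
  rw [Scheme.IdealSheafData.ideal_mul, Pi.mul_apply, h2, Ideal.mem_span_singleton_mul]
  refine ⟨b, ?_, by rw [mul_comm, hb]⟩
  change b ∈ (J.ideal U).colon ((K ^ n).ideal U)
  rw [h2, Ideal.mem_colon_span_singleton, hb]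
  exact ha

theorem pow_mul_birationalTransform_le (π : X' ⟶ X) (Z I : X.IdealSheafData) (m : ℕ) :
    (Z.comap π) ^ m * birationalTransform π Z I m ≤ I.comap π := by
  intro V
  rw [birationalTransform, Scheme.IdealSheafData.ideal_mul, Scheme.IdealSheafData.ideal_sSup,
    Pi.mul_apply, sSup_image, iSup_apply]
  simp only [iSup_apply, Ideal.mul_iSup]
  exact iSup₂_le fun J hJ => hJ V

theorem le_birationalTransform {π : X' ⟶ X} {Z I : X.IdealSheafData} {m : ℕ}
    {J : X'.IdealSheafData} (h : (Z.comap π) ^ m * J ≤ I.comap π) :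
    J ≤ birationalTransform π Z I m :=
  le_sSup h

/-- Since `birationalTransform` is a supremum, an explicit sheaf that attains it is needed: the
colon by the invertible `𝒪(-m F)`. With `pow_mul_birationalTransform_le` it yields the equality `π^*
I = 𝒪(-m F) * I'`. -/
theorem comap_le_pow_mul_birationalTransform (f : X ⟶ Spec (.of k)) {π : X' ⟶ X}
    {Z I : X.IdealSheafData} (hπ : IsBlowUp π Z) [Smooth (π ≫ f)] {m : ℕ} (h : I ≤ Z ^ m) :
    I.comap π ≤ (Z.comap π) ^ m * birationalTransform π Z I m := by
  have h1 : I.comap π ≤ (Z.comap π) ^ m := by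
    rw [← comap_pow]
    exact Scheme.IdealSheafData.comap_mono π h
  exact (le_mul_colonSheaf (π ≫ f) hπ.isInvertibleIdeal h1).trans
    (mul_le_mul_right (le_birationalTransform (mul_colonSheaf_le _ _ _)) _)

theorem birationalTransform_pow_le {π : X' ⟶ X} {Z I W : X.IdealSheafData} {a m : ℕ}
    (h : I ^ a ≤ W) :
    birationalTransform π Z I m ^ a ≤ birationalTransform π Z W (a * m) := by
  apply le_birationalTransform
  rw [mul_comm a m, pow_mul, ← mul_pow]
  calc _ ≤ (I.comap π) ^ a := pow_le_pow_left' (pow_mul_birationalTransform_le π Z I m) a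
    _ = (I ^ a).comap π := (comap_pow π I a).symm
    _ ≤ W.comap π := Scheme.IdealSheafData.comap_mono π h

end Transform

/-! ### Transforms and orders of coefficient ideals. -/

section Coeff

variable {k : Type u} [Field k] {X X' : Scheme.{u}}

/-- The maximal coefficient ideal of the marked ideal `(I, m)`. -/
def coeffIdeal (f : X ⟶ Spec (.of k)) (m s : ℕ) (I : X.IdealSheafData) : X.IdealSheafData :=
  ⨆ (c : ℕ → ℕ) (_ : s ≤ ∑ j ∈ Finset.range (m + 1), (m - j) * c j),
    ∏ j ∈ Finset.range (m + 1), iterDerivIdeal f j I ^ c j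

theorem prod_le_coeffIdeal (f : X ⟶ Spec (.of k)) {m s : ℕ} (I : X.IdealSheafData) {c : ℕ → ℕ}
    (h : s ≤ ∑ j ∈ Finset.range (m + 1), (m - j) * c j) :
    ∏ j ∈ Finset.range (m + 1), iterDerivIdeal f j I ^ c j ≤ coeffIdeal f m s I :=
  le_iSup₂ (f := fun (c : ℕ → ℕ) (_ : s ≤ ∑ j ∈ Finset.range (m + 1), (m - j) * c j) =>
    ∏ j ∈ Finset.range (m + 1), iterDerivIdeal f j I ^ c j) c h

theorem coeffIdeal_le {f : X ⟶ Spec (.of k)} {m s : ℕ} {I J : X.IdealSheafData}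
    (h : ∀ c : ℕ → ℕ, s ≤ ∑ j ∈ Finset.range (m + 1), (m - j) * c j →
      ∏ j ∈ Finset.range (m + 1), iterDerivIdeal f j I ^ c j ≤ J) : coeffIdeal f m s I ≤ J :=
  iSup₂_le h

theorem iterDerivIdeal_succ (f : X ⟶ Spec (.of k)) (j : ℕ) (I : X.IdealSheafData) :
    iterDerivIdeal f (j + 1) I = derivIdeal f (iterDerivIdeal f j I) :=
  Function.iterate_succ_apply' _ _ _

/-- Each derivative costs one copy of the exceptional divisor. -/
theorem comap_iterDerivIdeal_le (f : X ⟶ Spec (.of k)) [Smooth f] {π : X' ⟶ X}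
    {Z I : X.IdealSheafData} (hπ : IsBlowUp π Z) [Smooth (π ≫ f)] {m : ℕ} (h : I ≤ Z ^ m)
    {j : ℕ} (hj : j ≤ m) : (iterDerivIdeal f j I).comap π ≤
      (Z.comap π) ^ (m - j) * iterDerivIdeal (π ≫ f) j (birationalTransform π Z I m) := by
  induction j with
  | zero => exact comap_le_pow_mul_birationalTransform f hπ h
  | succ j ih =>
    have := ih (by omega)
    rw [show m - j = (m - (j + 1)) + 1 by omega] at this
    rw [iterDerivIdeal_succ, iterDerivIdeal_succ]
    exact comap_derivIdeal_le f hπ this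

/-- The weight `m - j` is precisely the power of the exceptional divisor carried by `D^j(I)`, so a
product of weight at least `s` is divisible by its `s`-th power, which is then cancelled. -/
theorem birationalTransform_le_coeffIdeal (f : X ⟶ Spec (.of k)) [Smooth f] {π : X' ⟶ X}
    {Z I W : X.IdealSheafData} (hπ : IsBlowUp π Z) [Smooth (π ≫ f)] {m s : ℕ} (h : I ≤ Z ^ m)
    (hW : W ≤ coeffIdeal f m s I) :
    birationalTransform π Z W s ≤ coeffIdeal (π ≫ f) m s (birationalTransform π Z I m) := by
  apply le_of_pow_mul_le_pow_mul hπ.isInvertibleIdeal (n := s)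
  refine (pow_mul_birationalTransform_le π Z W s).trans
    ((Scheme.IdealSheafData.comap_mono π hW).trans ?_)
  simp only [coeffIdeal, comap_iSup, comap_prod, comap_pow]
  refine iSup₂_le fun c hc => ?_
  calc ∏ j ∈ Finset.range (m + 1), (iterDerivIdeal f j I).comap π ^ c j
      ≤ ∏ j ∈ Finset.range (m + 1), ((Z.comap π) ^ (m - j) *
          iterDerivIdeal (π ≫ f) j (birationalTransform π Z I m)) ^ c j :=
        Finset.prod_le_prod' fun j hj => pow_le_pow_left' (comap_iterDerivIdeal_le f hπ h
          (by rw [Finset.mem_range] at hj; omega)) _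
    _ = (Z.comap π) ^ (∑ j ∈ Finset.range (m + 1), (m - j) * c j) *
          ∏ j ∈ Finset.range (m + 1),
            iterDerivIdeal (π ≫ f) j (birationalTransform π Z I m) ^ c j := by
        simp only [mul_pow, ← pow_mul, Finset.prod_mul_distrib, Finset.prod_pow_eq_pow_sum]
    _ ≤ _ := mul_le_mul' (pow_le_pow_right_of_le_one' le_top hc) (prod_le_coeffIdeal _ _ hc)

theorem stalkIdeal_prod {ι : Type*} (s : Finset ι) (I : ι → X.IdealSheafData) (x : X) :
    stalkIdeal (∏ i ∈ s, I i) x = ∏ i ∈ s, stalkIdeal (I i) x := by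
  classical
  induction s using Finset.induction_on with
  | empty =>
    obtain ⟨U, hU⟩ := exists_affine_mem x
    rw [Finset.prod_empty, Finset.prod_empty, stalkIdeal_eq_map _ U hU,
      Scheme.IdealSheafData.one_eq_top, Scheme.IdealSheafData.ideal_top, Pi.top_apply,
      Ideal.map_top, Ideal.one_eq_top]
  | insert a s ha ih => rw [Finset.prod_insert ha, Finset.prod_insert ha, stalkIdeal_mul, ih]

theorem sub_le_ordAt_iterDerivIdeal [CharZero k] (f : X ⟶ Spec (.of k)) [Smooth f]
    {I : X.IdealSheafData} {x : X} {r : ℕ} (h : (r : ℕ∞) ≤ ordAt I x) (j : ℕ) :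
    ((r - j : ℕ) : ℕ∞) ≤ ordAt (iterDerivIdeal f j I) x := by
  obtain ⟨U, hU⟩ := exists_affine_mem x
  rcases hn : r - j with _ | n
  · simp
  · obtain rfl : r = n + j + 1 := by omega
    rw [succ_le_ordAt_iff f _ U hU] at h ⊢
    rwa [iterDerivIdeal, iterDerivIdeal, ← Function.iterate_add_apply]

theorem le_ordAt_coeffIdeal [CharZero k] (f : X ⟶ Spec (.of k)) [Smooth f]
    {I : X.IdealSheafData} {x : X} {m r s t : ℕ} (h : (r : ℕ∞) ≤ ordAt I x)
    (hst : ∀ c : ℕ → ℕ, s ≤ ∑ j ∈ Finset.range (m + 1), (m - j) * c j →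
      t ≤ ∑ j ∈ Finset.range (m + 1), (r - j) * c j) :
    (t : ℕ∞) ≤ ordAt (coeffIdeal f m s I) x := by
  rw [le_ordAt_iff]
  simp only [coeffIdeal, stalkIdeal_iSup, stalkIdeal_prod, stalkIdeal_pow]
  refine iSup₂_le fun c hc => ?_
  refine le_trans ?_ (Ideal.pow_le_pow_right (hst c hc))
  rw [← Finset.prod_pow_eq_pow_sum]
  refine Finset.prod_le_prod' fun j _ => ?_
  rw [pow_mul]
  exact pow_le_pow_left' (le_ordAt_iff.1 (sub_le_ordAt_iterDerivIdeal f h j)) _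

end Coeff

/-! ### Comparing orders along blow-up sequences. -/

section Sequences

variable {k : Type u} [Field k] [CharZero k]

theorem le_ordAt_coeffIdeal_self {X : Scheme.{u}} (f : X ⟶ Spec (.of k)) [Smooth f]
    {I : X.IdealSheafData} {x : X} {m s : ℕ} (h : (m : ℕ∞) ≤ ordAt I x) :
    (s : ℕ∞) ≤ ordAt (coeffIdeal f m s I) x :=
  le_ordAt_coeffIdeal f h fun _ hc => hc

/-- One extra order of `I` raises every factor's order bound by one; `s ≠ 0` ensures that some
factor is present. -/
theorem succ_le_ordAt_coeffIdeal {X : Scheme.{u}} (f : X ⟶ Spec (.of k)) [Smooth f]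
    {I : X.IdealSheafData} {x : X} {m s : ℕ} (hs : s ≠ 0) (h : ((m + 1 : ℕ) : ℕ∞) ≤ ordAt I x) :
    ((s + 1 : ℕ) : ℕ∞) ≤ ordAt (coeffIdeal f m s I) x := by
  refine le_ordAt_coeffIdeal f h fun c hc => ?_
  refine (Nat.succ_le_succ hc).trans (Nat.succ_le_of_lt ?_)
  have hpos : 0 < ∑ j ∈ Finset.range (m + 1), (m - j) * c j := by omega
  obtain ⟨j, hj, hj0⟩ := Finset.exists_ne_zero_of_sum_ne_zero hpos.ne'
  refine Finset.sum_lt_sum (fun i _ => Nat.mul_le_mul_right _ (by omega)) ⟨j, hj, ?_⟩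
  rw [Finset.mem_range] at hj
  have : 0 < c j := Nat.pos_of_ne_zero fun h0 => hj0 (by rw [h0, mul_zero])
  exact Nat.mul_lt_mul_of_pos_right (by omega) this

theorem ordAlongGE_of_pow_le {X : Scheme.{u}} (f : X ⟶ Spec (.of k)) [Smooth f]
    {Z I W : X.IdealSheafData} {a m : ℕ} (ha : a ≠ 0) (hIW : I ^ a ≤ W)
    (h : OrdAlongGE Z W (a * m)) : OrdAlongGE Z I m := fun z hz =>
  le_ordAt_of_mul_le_ordAt_pow f ha ((h z hz).trans (ordAt_anti hIW z))

theorem OrdAlongEq.ordAlongGE {X : Scheme.{u}} {Z I : X.IdealSheafData} {m : ℕ}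
    (h : OrdAlongEq Z I m) : OrdAlongGE Z I m := fun z hz => (h z hz).ge

namespace SmoothBlowUpSeq

theorem HasOrderGE.of_pow_le {X : Scheme.{u}} {f : X ⟶ Spec (.of k)} (B : SmoothBlowUpSeq f)
    {I W : X.IdealSheafData} {a m : ℕ} (ha : a ≠ 0) (hIW : I ^ a ≤ W)
    (h : B.HasOrderGE W (a * m)) : B.HasOrderGE I m := by
  induction B with
  | nil => trivial
  | cons f Z π smooth smooth_center isBlowUp tail ih =>
    exact ⟨ordAlongGE_of_pow_le f ha hIW h.1, ih (birationalTransform_pow_le hIW) h.2⟩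

theorem HasOrderGE.of_le_coeffIdeal {X : Scheme.{u}} {f : X ⟶ Spec (.of k)}
    (B : SmoothBlowUpSeq f) {I W : X.IdealSheafData} {m s : ℕ} (hW : W ≤ coeffIdeal f m s I)
    (h : B.HasOrderGE I m) : B.HasOrderGE W s := by
  induction B with
  | nil => trivial
  | cons f Z π smooth smooth_center isBlowUp tail ih =>
    refine ⟨fun z hz => (le_ordAt_coeffIdeal_self f (h.1 z hz)).trans (ordAt_anti hW z), ?_⟩
    -- Smoothness of the blown-up scheme is recorded only in the next step of the sequence; if there
    -- is none, nothing remains to be shown.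
    cases tail with
    | nil => trivial
    | cons _ _ _ smooth' _ _ _ =>
      exact ih (birationalTransform_le_coeffIdeal f isBlowUp
        (le_pow_of_ordAlongGE f smooth_center h.1) hW) h.2

theorem HasOrderEq.hasOrderEq_iff {X : Scheme.{u}} {f : X ⟶ Spec (.of k)}
    (B : SmoothBlowUpSeq f) {I W : X.IdealSheafData} {a m : ℕ} (ha : a ≠ 0) (hm : m ≠ 0)
    (hIW : I ^ a ≤ W) (hW : W ≤ coeffIdeal f m (a * m) I) :
    B.HasOrderEq I m ↔ B.HasOrderEq W (a * m) := by
  induction B with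
  | nil => exact Iff.rfl
  | cons f Z π smooth smooth_center isBlowUp tail ih =>
    have hs : a * m ≠ 0 := mul_ne_zero ha hm
    have key : OrdAlongEq Z I m ↔ OrdAlongEq Z W (a * m) := by
      refine ⟨fun h z hz => le_antisymm ?_ ?_, fun h z hz => le_antisymm ?_ ?_⟩
      · by_contra hlt
        have h1 : ((a * m + 1 : ℕ) : ℕ∞) ≤ ordAt (I ^ a) z :=
          (Order.add_one_le_of_lt (not_le.1 hlt)).trans (ordAt_anti hIW z)
        have h2 := succ_le_ordAt_of_le_ordAt_pow f h1
        rw [h z hz, Nat.cast_le] at h2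
        omega
      · exact (le_ordAt_coeffIdeal_self f (h z hz).ge).trans (ordAt_anti hW z)
      · by_contra hlt
        have h1 : ((m + 1 : ℕ) : ℕ∞) ≤ ordAt I z := Order.add_one_le_of_lt (not_le.1 hlt)
        have h2 := (succ_le_ordAt_coeffIdeal f hs h1).trans (ordAt_anti hW z)
        rw [h z hz, Nat.cast_le] at h2
        omega
      · exact ordAlongGE_of_pow_le f ha hIW h.ordAlongGE z hz
    rw [HasOrderEq, HasOrderEq, ← key]
    refine and_congr_right fun h => ?_
    cases tail with
    | nil => exact Iff.rfl
    | cons _ _ _ smooth' _ _ _ =>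
      exact ih (birationalTransform_pow_le hIW) (birationalTransform_le_coeffIdeal f isBlowUp
        (le_pow_of_ordAlongGE f smooth_center h.ordAlongGE) hW)

end SmoothBlowUpSeq

end Sequences

/-! ### Bounds for the least common multiple and exact splitting of weights. -/

section Combinatorics

theorem lcm_Icc_succ {m : ℕ} (hm : 1 ≤ m) :
    (Finset.Icc 2 (m + 1)).lcm id = Nat.lcm (m + 1) ((Finset.Icc 2 m).lcm id) := by
  rw [← Finset.insert_Icc_right_eq_Icc_add_one (by omega), Finset.lcm_insert]
  rfl

theorem lcm_Icc_dvd_factorial (m : ℕ) : (Finset.Icc 2 m).lcm id ∣ m.factorial :=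
  Finset.lcm_dvd fun i hi => by
    obtain ⟨h1, h2⟩ := Finset.mem_Icc.1 hi
    exact Nat.dvd_factorial (show 0 < i by omega) h2

theorem dvd_lcm_Icc {m i : ℕ} (h1 : 1 ≤ i) (h2 : i ≤ m) : i ∣ (Finset.Icc 2 m).lcm id := by
  rcases h1.eq_or_lt with rfl | h1
  · exact one_dvd _
  · exact Finset.dvd_lcm (f := id) (Finset.mem_Icc.2 ⟨h1, h2⟩)

theorem lcm_Icc_pos (m : ℕ) : 0 < (Finset.Icc 2 m).lcm id :=
  Nat.pos_of_dvd_of_pos (lcm_Icc_dvd_factorial m) m.factorial_pos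

theorem lcm_mul_two_le {a b : ℕ} (ha : 2 ∣ a) (hb : 2 ∣ b) (h0 : 0 < a) :
    Nat.lcm a b * 2 ≤ a * b := by
  have h1 : 2 ≤ Nat.gcd a b := Nat.le_of_dvd (Nat.gcd_pos_of_pos_left _ h0) (Nat.dvd_gcd ha hb)
  calc Nat.lcm a b * 2 ≤ Nat.lcm a b * Nat.gcd a b := Nat.mul_le_mul_left _ h1
    _ = a * b := by rw [mul_comm, Nat.gcd_mul_lcm]

theorem lcm_le_mul {a b : ℕ} (ha : 0 < a) (hb : 0 < b) : Nat.lcm a b ≤ a * b :=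
  Nat.le_of_dvd (Nat.mul_pos ha hb) (Nat.lcm_dvd_mul a b)

/-- One of `m + 1`, `m + 2` is even, and so is the previous least common multiple, so a factor `2`
is saved. -/
theorem lcm_Icc_add_two_mul_two_le {m : ℕ} (hm : 2 ≤ m) :
    (Finset.Icc 2 (m + 2)).lcm id * 2 ≤ (m + 2) * ((m + 1) * (Finset.Icc 2 m).lcm id) := by
  have h2 : 2 ∣ (Finset.Icc 2 m).lcm id := dvd_lcm_Icc (by omega) hm
  have hpos := lcm_Icc_pos m
  rw [lcm_Icc_succ (by omega), lcm_Icc_succ (by omega)]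
  rcases Nat.even_or_odd m with h | h
  · calc _ ≤ (m + 1 + 1) * Nat.lcm (m + 1) ((Finset.Icc 2 m).lcm id) :=
          lcm_mul_two_le (by obtain ⟨k, rfl⟩ := h; omega)
            (h2.trans (Nat.dvd_lcm_right _ _)) (by omega)
      _ ≤ _ := Nat.mul_le_mul_left _ (lcm_le_mul (by omega) hpos)
  · calc _ ≤ (m + 1 + 1) * Nat.lcm (m + 1) ((Finset.Icc 2 m).lcm id) * 2 :=
          Nat.mul_le_mul_right _ (lcm_le_mul (by omega)
            (Nat.lcm_pos (by omega) hpos))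
      _ = (m + 1 + 1) * (Nat.lcm (m + 1) ((Finset.Icc 2 m).lcm id) * 2) := mul_assoc _ _ _
      _ ≤ _ := Nat.mul_le_mul_left _
        (lcm_mul_two_le (by obtain ⟨k, rfl⟩ := h; omega) h2 (by omega))

/-- Induction in steps of two from `m = 6` and `m = 7`: the saved factor `2` absorbs the growth of
`m - 1`. The bound is false for `m = 3, 4, 5`. -/
theorem pred_mul_lcm_Icc_le_factorial_of_six_le {m : ℕ} (hm : 6 ≤ m) :
    (m - 1) * (Finset.Icc 2 m).lcm id ≤ m.factorial := by
  induction m using Nat.strong_induction_on with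
  | _ m ih =>
    rcases hm.eq_or_lt with rfl | hm
    · decide
    rcases (Nat.succ_le_of_lt hm).eq_or_lt with rfl | hm
    · decide
    obtain ⟨n, rfl⟩ : ∃ n, m = n + 2 := ⟨m - 2, by omega⟩
    have h1 := ih n (by omega) (by omega)
    have h2 := lcm_Icc_add_two_mul_two_le (m := n) (by omega)
    obtain ⟨p, rfl⟩ : ∃ p, n = p + 6 := ⟨n - 6, by omega⟩
    rw [Nat.factorial_succ, Nat.factorial_succ]
    rw [show p + 6 - 1 = p + 5 by omega] at h1
    rw [show p + 6 + 2 - 1 = p + 7 by omega]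
    refine Nat.le_of_mul_le_mul_right (c := 2) ?_ (by norm_num)
    calc (p + 7) * (Finset.Icc 2 (p + 6 + 2)).lcm id * 2
        = (p + 7) * ((Finset.Icc 2 (p + 6 + 2)).lcm id * 2) := mul_assoc _ _ _
      _ ≤ (p + 7) * ((p + 6 + 2) * ((p + 6 + 1) * (Finset.Icc 2 (p + 6)).lcm id)) :=
          Nat.mul_le_mul_left _ h2
      _ = (p + 6 + 2) * (p + 6 + 1) * ((p + 7) * (Finset.Icc 2 (p + 6)).lcm id) := by ring
      _ ≤ (p + 6 + 2) * (p + 6 + 1) * (2 * ((p + 5) * (Finset.Icc 2 (p + 6)).lcm id)) := by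
          refine Nat.mul_le_mul_left _ ?_
          rw [← mul_assoc]
          exact Nat.mul_le_mul_right _ (by omega)
      _ ≤ (p + 6 + 2) * (p + 6 + 1) * (2 * (p + 6).factorial) := by gcongr
      _ = _ := by ring

/-- The weight of an exponent vector. -/
def weight (m : ℕ) (c : ℕ → ℕ) : ℕ := ∑ j ∈ Finset.range (m + 1), (m - j) * c j

theorem weight_add (m : ℕ) (c d : ℕ → ℕ) : weight m (c + d) = weight m c + weight m d := by
  simp only [weight, Pi.add_apply, mul_add, Finset.sum_add_distrib]

theorem weight_single {m j : ℕ} (hj : j ≤ m) (n : ℕ) :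
    weight m (Pi.single j n) = (m - j) * n := by
  rw [weight, Finset.sum_eq_single j]
  · simp
  · intro i _ hij
    simp [hij]
  · intro h
    exact absurd (Finset.mem_range.2 (Nat.lt_succ_of_le hj)) h

/-- Pigeonhole over the `m` indices `j < m` (index `m` has weight zero): some `j` alone contributes
at least `L`, and `m - j` divides `L`. -/
theorem exists_le_weight_eq_lcm {m : ℕ} (hm : 1 ≤ m) {c : ℕ → ℕ}
    (h : m * (Finset.Icc 2 m).lcm id ≤ weight m c) :
    ∃ d ≤ c, weight m d = (Finset.Icc 2 m).lcm id := by
  obtain ⟨j, hj, hjL⟩ : ∃ j ∈ Finset.range m, (Finset.Icc 2 m).lcm id ≤ (m - j) * c j := by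
    refine Finset.exists_le_of_sum_le ⟨0, Finset.mem_range.2 hm⟩ ?_
    rw [weight, Finset.sum_range_succ] at h
    simpa using h
  rw [Finset.mem_range] at hj
  obtain ⟨n, hn⟩ := dvd_lcm_Icc (m := m) (i := m - j) (by omega) (by omega)
  refine ⟨Pi.single j n, ?_, by rw [weight_single hj.le, hn]⟩
  intro i
  rcases eq_or_ne i j with rfl | hij
  · rw [Pi.single_eq_same]
    refine Nat.le_of_mul_le_mul_left ?_ (show 0 < m - i by omega)
    rwa [← hn]
  · simp [hij]

theorem exists_four_two_one {a b c n : ℕ} (h : 4 * n ≤ 4 * a + 2 * b + c) :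
    ∃ x ≤ a, ∃ y ≤ b, ∃ z ≤ c, 4 * x + 2 * y + z = 4 * n :=
  ⟨min a n, by omega, min b (2 * (n - min a n)), by omega,
    4 * n - 4 * min a n - 2 * min b (2 * (n - min a n)), by omega, by omega⟩

/-- Group equal weights into blocks of total `12`. At most two 4s, three 3s and five 2s stay
ungrouped, of weight `8 + 9 + 10 = 27`; the 1s fill any remaining gap. -/
theorem exists_blocks_twelve {a b c d n : ℕ} (h : 12 * n + 27 ≤ 4 * a + 3 * b + 2 * c + d) :
    ∃ x ≤ a, ∃ y ≤ b, ∃ z ≤ c, ∃ w ≤ d, 4 * x + 3 * y + 2 * z + w = 12 * n := by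
  obtain ⟨e, he⟩ : ∃ e, e = min (a / 3) n := ⟨_, rfl⟩
  obtain ⟨g, hg⟩ : ∃ g, g = min (b / 4) (n - e) := ⟨_, rfl⟩
  obtain ⟨i, hi⟩ : ∃ i, i = min (c / 6) (n - e - g) := ⟨_, rfl⟩
  exact ⟨3 * e, by omega, 4 * g, by omega, 6 * i, by omega, 12 * (n - e - g - i), by omega,
    by omega⟩

theorem exists_le_weight_eq_factorial {m : ℕ} (hm3 : 3 ≤ m) (hm5 : m ≤ 5) {c : ℕ → ℕ}
    (h : 2 * m.factorial ≤ weight m c) : ∃ d ≤ c, weight m d = m.factorial := by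
  have h01 : ∀ {x0 x1 x2 x3 x4 : ℕ}, x0 ≤ c 0 → x1 ≤ c 1 → x2 ≤ c 2 → x3 ≤ c 3 → x4 ≤ c 4 →
      (fun i : ℕ => match i with
        | 0 => x0 | 1 => x1 | 2 => x2 | 3 => x3 | 4 => x4 | _ => 0) ≤ c := by
    intro x0 x1 x2 x3 x4 h0 h1 h2 h3 h4 i
    match i with
    | 0 => exact h0
    | 1 => exact h1
    | 2 => exact h2
    | 3 => exact h3
    | 4 => exact h4
    | _ + 5 => exact Nat.zero_le _
  have fin : ∀ x0 x1 x2 x3 x4 : ℕ, x0 ≤ c 0 → x1 ≤ c 1 → x2 ≤ c 2 → x3 ≤ c 3 → x4 ≤ c 4 →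
      m * x0 + (m - 1) * x1 + (m - 2) * x2 + (m - 3) * x3 + (m - 4) * x4 = m.factorial →
      ∃ d ≤ c, weight m d = m.factorial := by
    intro x0 x1 x2 x3 x4 h0 h1 h2 h3 h4 he
    refine ⟨_, h01 h0 h1 h2 h3 h4, ?_⟩
    rw [← he]
    interval_cases m <;> simp [weight, Finset.sum_range_succ]
  interval_cases m <;> simp only [weight, Finset.sum_range_succ, Finset.sum_range_zero] at h <;>
    norm_num [Nat.factorial] at h fin ⊢
  · by_cases h0 : 2 ≤ c 0
    · exact fin 2 0 0 0 0 (by omega) (by omega) (by omega) (by omega) (by omega) (by omega)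
    by_cases h1 : 3 ≤ c 1
    · exact fin 0 3 0 0 0 (by omega) (by omega) (by omega) (by omega) (by omega) (by omega)
    by_cases h2 : 6 ≤ c 2
    · exact fin 0 0 6 0 0 (by omega) (by omega) (by omega) (by omega) (by omega) (by omega)
    -- Here the weight is at most `3 + 4 + 5 = 12`, so equality holds and one factor of each kind
    -- gives `6`.
    exact fin 1 1 1 0 0 (by omega) (by omega) (by omega) (by omega) (by omega) (by omega)
  -- For `m = 4` only the weight 3 fails to fit the divisibility chain `4, 2, 1`; it is used in
  -- total amount `24`, `12` or `0`.
  · by_cases h1 : 8 ≤ c 1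
    · exact fin 0 8 0 0 0 (by omega) (by omega) (by omega) (by omega) (by omega) (by omega)
    by_cases h2 : 4 ≤ c 1
    · obtain ⟨x, hx, y, hy, z, hz, he⟩ := exists_four_two_one (a := c 0) (b := c 2) (c := c 3)
        (n := 3) (by omega)
      exact fin x 4 y z 0 hx h2 hy hz (by omega) (by omega)
    · obtain ⟨x, hx, y, hy, z, hz, he⟩ := exists_four_two_one (a := c 0) (b := c 2) (c := c 3)
        (n := 6) (by omega)
      exact fin x 0 y z 0 hx (by omega) hy hz (by omega) (by omega)
  -- For `m = 5` the weight 5 is used in total amount `120`, `60` or `0`, and blocks of `12` supply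
  -- the rest.
  · by_cases h1 : 24 ≤ c 0
    · exact fin 24 0 0 0 0 (by omega) (by omega) (by omega) (by omega) (by omega) (by omega)
    by_cases h2 : 12 ≤ c 0
    · obtain ⟨x, hx, y, hy, z, hz, w, hw, he⟩ := exists_blocks_twelve (a := c 1) (b := c 2)
        (c := c 3) (d := c 4) (n := 5) (by omega)
      exact fin 12 x y z w h2 hx hy hz hw (by omega)
    · obtain ⟨x, hx, y, hy, z, hz, w, hw, he⟩ := exists_blocks_twelve (a := c 1) (b := c 2)
        (c := c 3) (d := c 4) (n := 10) (by omega)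
      exact fin 0 x y z w (by omega) hx hy hz hw (by omega)

end Combinatorics

/-! ### Recovering a filtration from derivatives of its next member. -/

section Filtration

variable {k A : Type*} [Field k] [CommRing A] [Algebra k A]

/-- If a multiplicative filtration `F` is compatible with derivations and `F 1` generates the unit
ideal after taking derivatives, then every member is generated by derivatives of the next one. -/
theorem le_diffIdeal_filtration [CharZero k] {F : ℕ → Ideal A} (hanti : Antitone F)
    (hmul : ∀ s t, F s * F t ≤ F (s + t))
    (hder : ∀ s (δ : Derivation k A A), ∀ g ∈ F s, δ g ∈ F (s - 1))
    (htop : diffIdeal k (F 1) = ⊤) (s : ℕ) : F s ≤ diffIdeal k (F (s + 1)) := by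
  intro g hg
  let Q := diffIdeal k (F (s + 1))
  have hQ : F (s + 1) ≤ Q := le_diffIdeal _
  have hiter : ∀ (δ : Derivation k A A) (j : ℕ), δ^[j] g ∈ F (s - j) := fun δ j => by
    induction j with
    | zero => exact hg
    | succ j ih =>
      rw [Function.iterate_succ_apply']
      exact hder _ δ _ ih
  have hpow : ∀ y ∈ F 1, ∀ j, y ^ (j + 1) ∈ F (j + 1) := fun y hy j => by
    induction j with
    | zero => simpa using hy
    | succ j ih =>
      rw [pow_succ]
      exact hmul _ _ (Ideal.mul_mem_mul ih hy)
  -- Powers of `y` are traded for powers of `δ y`: differentiating `y ^ (j + 1) * δ^[j] g`, which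
  -- lies in `F (s + 1)`, gives `j + 1` times the wanted term plus the term already treated.
  have key : ∀ (δ : Derivation k A A), ∀ y ∈ F 1, ∀ i j, i + j = s + 1 →
      δ y ^ i * (y ^ j * δ^[j] g) ∈ Q := by
    intro δ y hy i
    induction i with
    | zero =>
      rintro j hj
      obtain rfl : j = s + 1 := by omega
      exact Ideal.mul_mem_left _ _ (Ideal.mul_mem_right _ _ (hQ (hpow y hy s)))
    | succ i ih =>
      intro j hj
      have h1 := ih (j + 1) (by omega)
      have h2 : y ^ (j + 1) * δ^[j] g ∈ F (s + 1) :=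
        hanti (by omega) (hmul _ _ (Ideal.mul_mem_mul (hpow y hy j) (hiter δ j)))
      have h3 := Ideal.mul_mem_left Q (δ y ^ i) (derivation_mem_diffIdeal δ h2)
      rw [← natCast_mul_mem_iff (k := k) (Nat.succ_ne_zero j)]
      have h4 := sub_mem h3 h1
      rw [Function.iterate_succ_apply', Derivation.leibniz, Derivation.leibniz_pow] at h4
      convert h4 using 1
      simp only [smul_eq_mul, nsmul_eq_mul, Nat.add_sub_cancel]
      push_cast
      ring
  -- At the end of the trade `δ y ^ (s + 1) * g` lies in `Q`. So the unit ideal `diffIdeal k (F 1)`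
  -- lies in the radical of the colon of `Q` by `g`.
  have h1 : diffIdeal k (F 1) ≤ (Q.colon (Ideal.span {g})).radical := by
    refine diffIdeal_le (fun y hy => Ideal.le_radical ?_) fun δ y hy => ⟨s + 1, ?_⟩
    · rw [Ideal.mem_colon_span_singleton]
      refine hQ ?_
      rw [add_comm]
      exact hmul _ _ (Ideal.mul_mem_mul hy hg)
    · rw [Ideal.mem_colon_span_singleton]
      simpa using key δ y hy (s + 1) 0 rfl
  rw [htop, top_le_iff, Ideal.radical_eq_top, Ideal.eq_top_iff_one,
    Ideal.mem_colon_span_singleton, one_mul] at h1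
  exact h1

end Filtration

/-! ### Leibniz rule for sheaves, and maximal order via derivatives. -/

section Sheaf

variable {k : Type u} [Field k] {X : Scheme.{u}}

theorem iSup_mul {ι : Sort*} (J : ι → X.IdealSheafData) (K : X.IdealSheafData) :
    (⨆ i, J i) * K = ⨆ i, J i * K := by
  refine le_antisymm (fun U => ?_) (iSup_le fun i => mul_le_mul_left (le_iSup J i) K)
  have h : ∀ J : ι → X.IdealSheafData, (⨆ i, J i).ideal U = ⨆ i, (J i).ideal U := fun J => by
    rw [iSup, Scheme.IdealSheafData.ideal_sSup, sSup_image, iSup_range, iSup_apply]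
  rw [Scheme.IdealSheafData.ideal_mul, Pi.mul_apply, h, h, Ideal.iSup_mul]
  rfl

theorem derivIdeal_iSup_le {f : X ⟶ Spec (.of k)} [Smooth f] {ι : Sort*}
    {J : ι → X.IdealSheafData} {K : X.IdealSheafData} (h : ∀ i, derivIdeal f (J i) ≤ K) :
    derivIdeal f (⨆ i, J i) ≤ K := by
  refine derivIdeal_le (iSup_le fun i => (le_derivIdeal f _).trans (h i)) fun U δ g hg => ?_
  rw [iSup, Scheme.IdealSheafData.ideal_sSup, sSup_image, iSup_range, iSup_apply] at hg
  induction hg using Submodule.iSup_induction' with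
  | mem i x hx => exact h i U (derivation_mem_derivIdeal f δ hx)
  | zero => rw [map_zero]; exact zero_mem _
  | add x y _ _ hx hy => rw [map_add]; exact add_mem hx hy

theorem derivIdeal_mul_le (f : X ⟶ Spec (.of k)) [Smooth f] (J K : X.IdealSheafData) :
    derivIdeal f (J * K) ≤ derivIdeal f J * K ⊔ J * derivIdeal f K := by
  refine derivIdeal_le ((mul_le_mul_left (le_derivIdeal f J) K).trans le_sup_left)
    fun U δ g hg => ?_
  let := sectionAlgebra f U.1
  rw [Scheme.IdealSheafData.ideal_mul, Pi.mul_apply] at hg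
  induction hg using Submodule.mul_induction_on' with
  | mem_mul_mem a ha b hb =>
    rw [Derivation.leibniz, smul_eq_mul, smul_eq_mul, add_comm, mul_comm b]
    exact Ideal.add_mem _ (Ideal.mem_sup_left
        (Ideal.mul_mem_mul (derivation_mem_derivIdeal f δ ha) hb))
      (Ideal.mem_sup_right (Ideal.mul_mem_mul ha (derivation_mem_derivIdeal f δ hb)))
  | add x _ y _ hx hy => rw [map_add]; exact add_mem hx hy

/-- The locus of order `> n` is the zero locus of `D^n(I)`, and an ideal with no zeros is the unit
ideal. -/
theorem iterDerivIdeal_eq_top_iff [CharZero k] (f : X ⟶ Spec (.of k)) [Smooth f]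
    {I : X.IdealSheafData} {n : ℕ} : iterDerivIdeal f n I = ⊤ ↔ maxOrd I ≤ n := by
  constructor
  · refine fun h => iSup_le fun x => ?_
    obtain ⟨U, hU⟩ := exists_affine_mem x
    by_contra hlt
    have h1 := (succ_le_ordAt_iff f I U hU n).1 (Order.add_one_le_of_lt (not_le.1 hlt))
    rw [h, Scheme.IdealSheafData.ideal_top, Pi.top_apply] at h1
    exact Ideal.IsPrime.ne_top inferInstance (top_le_iff.1 h1)
  · refine fun h => top_le_iff.1 fun U => ?_
    by_contra hne
    obtain ⟨M, hM, hle⟩ := Ideal.exists_le_maximal _ (fun h => hne h.ge)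
    obtain ⟨x, hx, hM'⟩ := exists_pointIdeal_eq U M
    have h1 : ((n + 1 : ℕ) : ℕ∞) ≤ ordAt I x := (succ_le_ordAt_iff f I U hx n).2 (hM' ▸ hle)
    have h2 := h1.trans ((le_iSup _ x).trans h)
    rw [Nat.cast_le] at h2
    omega

theorem exists_le_ordAt {I : X.IdealSheafData} {m : ℕ} (hm : 1 ≤ m) (h : maxOrd I = m) :
    ∃ x, (m : ℕ∞) ≤ ordAt I x := by
  by_contra! hlt
  have h1 : maxOrd I ≤ (m - 1 : ℕ) := iSup_le fun x => by
    refine Order.le_of_lt_add_one ((hlt x).trans_eq ?_)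
    rw [← ENat.natCast_one, ← Nat.cast_add, Nat.sub_add_cancel hm]
  rw [h, Nat.cast_le] at h1
  omega

end Sheaf

/-! ### Formal properties of the coefficient ideals. -/

section Coeff

variable {k : Type u} [Field k] {X : Scheme.{u}} (f : X ⟶ Spec (.of k))
  {I : X.IdealSheafData} {m : ℕ}

theorem coeffIdeal_antitone (m : ℕ) (I : X.IdealSheafData) :
    Antitone fun s => coeffIdeal f m s I :=
  fun _ _ h => coeffIdeal_le fun _ hc => prod_le_coeffIdeal f I (h.trans hc)

theorem coeffIdeal_zero (m : ℕ) (I : X.IdealSheafData) : coeffIdeal f m 0 I = ⊤ := by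
  refine top_le_iff.1 (le_trans (le_of_eq ?_) (prod_le_coeffIdeal f (c := 0) I (Nat.zero_le _)))
  simp only [Pi.zero_apply, pow_zero, Finset.prod_const_one]
  rfl

theorem coeffIdeal_mul_le (m s t : ℕ) (I : X.IdealSheafData) :
    coeffIdeal f m s I * coeffIdeal f m t I ≤ coeffIdeal f m (s + t) I := by
  rw [coeffIdeal, iSup_mul]
  refine iSup_le fun c => ?_
  rw [iSup_mul]
  refine iSup_le fun hc => ?_
  rw [mul_comm, coeffIdeal, iSup_mul]
  refine iSup_le fun d => ?_
  rw [iSup_mul]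
  refine iSup_le fun hd => ?_
  rw [mul_comm, ← Finset.prod_mul_distrib]
  simp only [← pow_add]
  exact prod_le_coeffIdeal f I (c := c + d) ((add_le_add hc hd).trans_eq (weight_add m c d).symm)

theorem coeffIdeal_pow_le (m s n : ℕ) (I : X.IdealSheafData) :
    coeffIdeal f m s I ^ n ≤ coeffIdeal f m (n * s) I := by
  induction n with
  | zero => rw [zero_mul, coeffIdeal_zero]; exact le_top
  | succ n ih =>
    rw [pow_succ, Nat.succ_mul]
    exact (mul_le_mul_left ih _).trans (coeffIdeal_mul_le f m _ _ I)

theorem iterDerivIdeal_pow_le_coeffIdeal {j : ℕ} (hj : j ≤ m) (n : ℕ) :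
    iterDerivIdeal f j I ^ n ≤ coeffIdeal f m ((m - j) * n) I := by
  refine le_trans (le_of_eq ?_)
    (prod_le_coeffIdeal f I (c := Pi.single j n) (weight_single hj n).ge)
  rw [Finset.prod_eq_single j]
  · rw [Pi.single_eq_same]
  · intro i _ hij
    rw [Pi.single_eq_of_ne hij, pow_zero]
  · intro h
    exact absurd (Finset.mem_range.2 (Nat.lt_succ_of_le hj)) h

theorem iterDerivIdeal_le_coeffIdeal {j : ℕ} (hj : j ≤ m) :
    iterDerivIdeal f j I ≤ coeffIdeal f m (m - j) I := by
  simpa using iterDerivIdeal_pow_le_coeffIdeal f (I := I) hj 1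

theorem iterDerivIdeal_monotone (I : X.IdealSheafData) :
    Monotone fun j => iterDerivIdeal f j I :=
  monotone_nat_of_le_succ fun j => by
    rw [iterDerivIdeal_succ]
    exact le_derivIdeal f _

/-- A product of positive weight contains some `D^j(I)` with `j < m`, and `D^(m-1)(I)` is the
largest of these. -/
theorem coeffIdeal_one (hm : 1 ≤ m) : coeffIdeal f m 1 I = iterDerivIdeal f (m - 1) I := by
  apply le_antisymm
  · refine coeffIdeal_le fun c hc => ?_
    obtain ⟨j, hj, hj0⟩ := Finset.exists_ne_zero_of_sum_ne_zero (Nat.one_le_iff_ne_zero.1 hc)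
    have h1 := left_ne_zero_of_mul hj0
    have h2 := right_ne_zero_of_mul hj0
    calc _ ≤ iterDerivIdeal f j I ^ c j := by
          rw [← Finset.mul_prod_erase _ _ hj]
          exact mul_le_of_le_one_right' le_top
      _ ≤ iterDerivIdeal f j I ^ 1 :=
          pow_le_pow_right_of_le_one' le_top (Nat.one_le_iff_ne_zero.2 h2)
      _ = iterDerivIdeal f j I := pow_one _
      _ ≤ _ := iterDerivIdeal_monotone f I (by omega)
  · have := iterDerivIdeal_le_coeffIdeal f (I := I) (m := m) (j := m - 1) (by omega)
    rwa [show m - (m - 1) = 1 by omega] at this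

theorem derivIdeal_coeffIdeal_le [Smooth f] (s : ℕ) :
    derivIdeal f (coeffIdeal f m s I) ≤ coeffIdeal f m (s - 1) I := by
  -- By Leibniz this property is stable under products with weights adding, so it need only be
  -- checked on the factors `D^j(I)`.
  let P : X.IdealSheafData → ℕ → Prop := fun K w =>
    K ≤ coeffIdeal f m w I ∧ derivIdeal f K ≤ coeffIdeal f m (w - 1) I
  have hone : P 1 0 := ⟨by rw [coeffIdeal_zero]; exact le_top, by
    rw [Nat.zero_sub, coeffIdeal_zero]; exact le_top⟩
  have hmul : ∀ {K K' w w'}, P K w → P K' w' → P (K * K') (w + w') := fun {K K' w w'} h h' => by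
    refine ⟨(mul_le_mul' h.1 h'.1).trans (coeffIdeal_mul_le f m _ _ I),
      (derivIdeal_mul_le f K K').trans (sup_le ?_ ?_)⟩
    · exact (mul_le_mul' h.2 h'.1).trans ((coeffIdeal_mul_le f m _ _ I).trans
        (coeffIdeal_antitone f m I (by omega)))
    · exact (mul_le_mul' h.1 h'.2).trans ((coeffIdeal_mul_le f m _ _ I).trans
        (coeffIdeal_antitone f m I (by omega)))
  have hpow : ∀ {K w}, P K w → ∀ n, P (K ^ n) (w * n) := fun {K w} h n => by
    induction n with
    | zero => rw [pow_zero]; exact hone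
    | succ n ih => rw [pow_succ, Nat.mul_succ]; exact hmul ih h
  have hiter : ∀ j ≤ m, P (iterDerivIdeal f j I) (m - j) := fun j hj => by
    refine ⟨iterDerivIdeal_le_coeffIdeal f hj, ?_⟩
    rw [← iterDerivIdeal_succ]
    rcases hj.eq_or_lt with rfl | hj
    · rw [Nat.sub_self, Nat.zero_sub, coeffIdeal_zero]
      exact le_top
    · rw [Nat.sub_sub]
      exact iterDerivIdeal_le_coeffIdeal f hj
  have hprod : ∀ (c : ℕ → ℕ) (S : Finset ℕ), (∀ j ∈ S, j ≤ m) →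
      P (∏ j ∈ S, iterDerivIdeal f j I ^ c j) (∑ j ∈ S, (m - j) * c j) := fun c S hS => by
    induction S using Finset.induction_on with
    | empty => exact hone
    | insert a S ha ih =>
      rw [Finset.prod_insert ha, Finset.sum_insert ha]
      exact hmul (hpow (hiter a (hS a (Finset.mem_insert_self a S))) _)
        (ih fun j hj => hS j (Finset.mem_insert_of_mem hj))
  refine derivIdeal_iSup_le fun c => derivIdeal_iSup_le fun hc => ?_
  exact (hprod c _ fun j hj => Nat.le_of_lt_succ (Finset.mem_range.1 hj)).2.trans
    (coeffIdeal_antitone f m I (Nat.sub_le_sub_right hc 1))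

variable [CharZero k] [Smooth f]

theorem derivIdeal_coeffIdeal (hm : 1 ≤ m) (hI : maxOrd I ≤ m) (s : ℕ) :
    derivIdeal f (coeffIdeal f m (s + 1) I) = coeffIdeal f m s I := by
  refine le_antisymm (derivIdeal_coeffIdeal_le f (s + 1)) fun U => ?_
  let := sectionAlgebra f U.1
  rw [ideal_derivIdeal]
  refine le_diffIdeal_filtration (F := fun s => (coeffIdeal f m s I).ideal U)
    (fun _ _ h => coeffIdeal_antitone f m I h U) (fun s t => coeffIdeal_mul_le f m s t I U)
    (fun s δ g hg => derivIdeal_coeffIdeal_le f s U (derivation_mem_derivIdeal f δ hg)) ?_ s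
  rw [← ideal_derivIdeal, coeffIdeal_one f hm, ← iterDerivIdeal_succ, Nat.sub_add_cancel hm,
    (iterDerivIdeal_eq_top_iff f).2 hI]
  rfl

theorem iterDerivIdeal_coeffIdeal (hm : 1 ≤ m) (hI : maxOrd I ≤ m) (s n : ℕ) :
    iterDerivIdeal f n (coeffIdeal f m (s + n) I) = coeffIdeal f m s I := by
  induction n generalizing s with
  | zero => rfl
  | succ n ih =>
    rw [iterDerivIdeal_succ, ← add_assoc, add_right_comm, ih, derivIdeal_coeffIdeal f hm hI]

theorem maxOrd_coeffIdeal (hm : 1 ≤ m) (hI : maxOrd I = m) (s : ℕ) :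
    maxOrd (coeffIdeal f m s I) = s := by
  apply le_antisymm
  · rw [← iterDerivIdeal_eq_top_iff f, ← coeffIdeal_zero f m I]
    simpa using iterDerivIdeal_coeffIdeal f hm hI.le 0 s
  · obtain ⟨x, hx⟩ := exists_le_ordAt hm hI
    exact (le_ordAt_coeffIdeal_self f hx).trans (le_iSup (ordAt _) x)

theorem maxContactIdeal_coeffIdeal (hm : 1 ≤ m) (hI : maxOrd I = m) {s : ℕ} (hs : 1 ≤ s) :
    maxContactIdeal f (coeffIdeal f m s I) = coeffIdeal f m 1 I := by
  rw [maxContactIdeal, maxOrd_coeffIdeal f hm hI, ENat.toNat_natCast,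
    ← iterDerivIdeal_coeffIdeal f hm hI.le 1 (s - 1), Nat.add_sub_cancel' hs]

theorem isMCInvariant_coeffIdeal (hm : 1 ≤ m) (hI : maxOrd I = m) {s : ℕ} (hs : 1 ≤ s) :
    IsMCInvariant f (coeffIdeal f m s I) := by
  rw [IsMCInvariant, maxContactIdeal_coeffIdeal f hm hI hs]
  have h := coeffIdeal_mul_le f m 1 (s - 1) I
  rwa [← derivIdeal_coeffIdeal f hm hI.le (s - 1), Nat.sub_add_cancel hs,
    Nat.add_sub_cancel' hs] at h

/-- `D^i(W_s) ^ s = W_(s-i) ^ s ⊆ W_(s(s-i)) = W_s ^ (s-i)`. -/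
theorem isDBalanced_coeffIdeal (hm : 1 ≤ m) (hI : maxOrd I = m) {s : ℕ}
    (h : ∀ n, coeffIdeal f m s I ^ n = coeffIdeal f m (n * s) I) :
    IsDBalanced f (coeffIdeal f m s I) := by
  rw [IsDBalanced, maxOrd_coeffIdeal f hm hI, ENat.toNat_natCast]
  intro i hi
  have h1 := iterDerivIdeal_coeffIdeal f hm hI.le (s - i) i
  rw [Nat.sub_add_cancel hi.le] at h1
  rw [h1, h, mul_comm]
  exact coeffIdeal_pow_le f m _ _ I

end Coeff

/-! ### Products and powers of coefficient ideals. -/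

section Splitting

variable {k : Type u} [Field k] {X : Scheme.{u}} (f : X ⟶ Spec (.of k))
  {I : X.IdealSheafData} {m : ℕ}

/-- Splitting off weight exactly `s` wastes nothing, so the complementary factor keeps weight at
least `t`. -/
theorem coeffIdeal_add_of_forall_exists_le {s t : ℕ}
    (h : ∀ c : ℕ → ℕ, s + t ≤ weight m c → ∃ d ≤ c, weight m d = s) :
    coeffIdeal f m s I * coeffIdeal f m t I = coeffIdeal f m (s + t) I := by
  refine le_antisymm (coeffIdeal_mul_le f m s t I) (coeffIdeal_le fun c hc => ?_)
  obtain ⟨d, hdc, hd⟩ := h c hc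
  obtain ⟨e, rfl⟩ := exists_add_of_le hdc
  have h1 : s + t ≤ weight m (d + e) := hc
  rw [weight_add, hd, Nat.add_le_add_iff_left] at h1
  simp only [Pi.add_apply, pow_add, Finset.prod_mul_distrib]
  exact mul_le_mul' (prod_le_coeffIdeal f I hd.ge) (prod_le_coeffIdeal f I h1)

theorem coeffIdeal_pow_of_forall_exists_le {s : ℕ}
    (h : ∀ c : ℕ → ℕ, 2 * s ≤ weight m c → ∃ d ≤ c, weight m d = s) (n : ℕ) :
    coeffIdeal f m s I ^ n = coeffIdeal f m (n * s) I := by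
  induction n with
  | zero => rw [zero_mul, coeffIdeal_zero, pow_zero]; rfl
  | succ n ih =>
    rcases n.eq_zero_or_pos with rfl | hn
    · simp
    rw [pow_succ', ih, Nat.succ_mul, Nat.add_comm, coeffIdeal_add_of_forall_exists_le]
    intro c hc
    refine h c (le_trans ?_ hc)
    rw [two_mul]
    exact Nat.add_le_add_left (Nat.le_mul_of_pos_left s hn) s

theorem coeffIdeal_mul_lcm_add (hm : 1 ≤ m) (r : ℕ) {t : ℕ}
    (ht : (m - 1) * (Finset.Icc 2 m).lcm id ≤ t) :
    coeffIdeal f m (r * (Finset.Icc 2 m).lcm id) I * coeffIdeal f m t I =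
      coeffIdeal f m (r * (Finset.Icc 2 m).lcm id + t) I := by
  have key : ∀ {t}, (m - 1) * (Finset.Icc 2 m).lcm id ≤ t →
      coeffIdeal f m ((Finset.Icc 2 m).lcm id) I * coeffIdeal f m t I =
        coeffIdeal f m ((Finset.Icc 2 m).lcm id + t) I := fun {t} ht =>
    -- The bound on `t` makes the total weight at least `m * L`, the pigeonhole threshold.
    coeffIdeal_add_of_forall_exists_le f fun c hc => exists_le_weight_eq_lcm hm (by
      refine le_trans ?_ hc
      obtain ⟨n, rfl⟩ := Nat.exists_eq_add_of_le' hm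
      rw [Nat.add_sub_cancel] at ht
      rw [Nat.succ_mul, add_comm]
      exact Nat.add_le_add_left ht _)
  induction r with
  | zero => rw [zero_mul, zero_add, coeffIdeal_zero, Scheme.IdealSheafData.top_mul]
  | succ r ih =>
    refine le_antisymm (coeffIdeal_mul_le f m _ _ I) ?_
    rw [Nat.succ_mul, add_comm (r * _), add_assoc, ← key (ht.trans (Nat.le_add_left _ _)), ← ih,
      ← mul_assoc]
    exact mul_le_mul_left (coeffIdeal_mul_le f m _ _ I) _

theorem coeffIdeal_mul_lcm_pow (hm : 1 ≤ m) {r : ℕ} (hr : m - 1 ≤ r) (n : ℕ) :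
    coeffIdeal f m (r * (Finset.Icc 2 m).lcm id) I ^ n =
      coeffIdeal f m (n * (r * (Finset.Icc 2 m).lcm id)) I := by
  induction n with
  | zero => rw [zero_mul, coeffIdeal_zero, pow_zero]; rfl
  | succ n ih =>
    rw [pow_succ, ih, Nat.succ_mul, ← mul_assoc,
      coeffIdeal_mul_lcm_add f hm (n * r) (Nat.mul_le_mul_right _ hr)]

theorem coeffIdeal_factorial_pow (hm : 1 ≤ m) (n : ℕ) :
    coeffIdeal f m m.factorial I ^ n = coeffIdeal f m (n * m.factorial) I := by
  by_cases h : 3 ≤ m ∧ m ≤ 5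
  · exact coeffIdeal_pow_of_forall_exists_le f
      (fun c hc => exists_le_weight_eq_factorial h.1 h.2 hc) n
  · have h1 : (m - 1) * (Finset.Icc 2 m).lcm id ≤ m.factorial := by
      rcases le_or_gt 6 m with h6 | h6
      · exact pred_mul_lcm_Icc_le_factorial_of_six_le h6
      · have : m = 1 ∨ m = 2 := by omega
        rcases this with rfl | rfl <;> decide
    obtain ⟨r, hr⟩ := lcm_Icc_dvd_factorial m
    rw [hr, mul_comm]
    refine coeffIdeal_mul_lcm_pow f hm ?_ n
    rw [hr, mul_comm] at h1
    exact Nat.le_of_mul_le_mul_left h1 (lcm_Icc_pos m)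

end Splitting

/-! ### The admissible values of `s`. -/

section Tuning

variable {k : Type u} [Field k] {X : Scheme.{u}} (f : X ⟶ Spec (.of k))
  {I : X.IdealSheafData} {m : ℕ}

theorem maxCoeffIdeal_eq_coeffIdeal (hI : maxOrd I = m) (s : ℕ) :
    maxCoeffIdeal f s I = coeffIdeal f m s I := by
  rw [maxCoeffIdeal, hI, ENat.toNat_natCast]
  rfl

theorem exists_eq_mul_and_coeffIdeal_pow (hm : 1 ≤ m) {s : ℕ}
    (hs : (∃ r, 1 ≤ r ∧ m - 1 ≤ r ∧ s = r * (Finset.Icc 2 m).lcm id) ∨ s = m.factorial) :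
    (∃ a, a ≠ 0 ∧ s = a * m) ∧
      ∀ n, coeffIdeal f m s I ^ n = coeffIdeal f m (n * s) I := by
  have h1 : 0 < s ∧ m ∣ s := by
    rcases hs with ⟨r, hr, -, rfl⟩ | rfl
    · exact ⟨Nat.mul_pos hr (lcm_Icc_pos m), (dvd_lcm_Icc hm le_rfl).mul_left r⟩
    · exact ⟨m.factorial_pos, Nat.dvd_factorial hm le_rfl⟩
  refine ⟨?_, fun n => ?_⟩
  · obtain ⟨h0, a, rfl⟩ := h1
    exact ⟨a, (Nat.pos_of_mul_pos_left h0).ne', mul_comm _ _⟩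
  · rcases hs with ⟨r, -, hr, rfl⟩ | rfl
    · exact coeffIdeal_mul_lcm_pow f hm hr n
    · exact coeffIdeal_factorial_pow f hm n

end Tuning

end IdealTuning

theorem mainTheorem12 {k : Type u} [Field k] [CharZero k] {X : Scheme.{u}}
    (f : X ⟶ Spec (.of k)) [Smooth f] (I : X.IdealSheafData) (m : ℕ) (hm : 1 ≤ m)
    (hI : IdealTuning.maxOrd I = (m : ℕ∞)) :
    let W : ℕ → X.IdealSheafData := fun s => IdealTuning.maxCoeffIdeal f s I
    let L : ℕ := (Finset.Icc 2 m).lcm id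
    -- general properties of the maximal coefficient ideals
    (∀ s, W (s + 1) ≤ W s) ∧
    (∀ s t, W s * W t ≤ W (s + t)) ∧
    (∀ s, IdealTuning.derivIdeal f (W (s + 1)) = W s) ∧
    (∀ s, 1 ≤ s → IdealTuning.maxContactIdeal f (W s) = W 1) ∧
    W 1 = IdealTuning.maxContactIdeal f I ∧
    (∀ s, IdealTuning.maxOrd (W s) = (s : ℕ∞)) ∧
    (∀ s, 1 ≤ s → IdealTuning.IsMCInvariant f (W s)) ∧
    (∀ r t, (m - 1) * L ≤ t → W (r * L) * W t = W (r * L + t)) ∧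
    (∀ r j, m - 1 ≤ r → W (r * L) ^ j = W (j * (r * L))) ∧
    -- the tuned ideals
    (∀ s, ((∃ r, 1 ≤ r ∧ m - 1 ≤ r ∧ s = r * L) ∨ s = m.factorial) →
      IdealTuning.IsMCInvariant f (W s) ∧
      IdealTuning.IsDBalanced f (W s) ∧
      (∀ E : List X.IdealSheafData, IdealTuning.IsSNCDivisor f E →
        ∀ B : IdealTuning.SmoothBlowUpSeq f, B.IsOfOrderGE I m E ↔ B.IsOfOrderGE (W s) s E) ∧
      (∀ B : IdealTuning.SmoothBlowUpSeq f, B.HasOrderGE I m ↔ B.HasOrderGE (W s) s) ∧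
      (∀ B : IdealTuning.SmoothBlowUpSeq f, B.HasOrderEq I m ↔ B.HasOrderEq (W s) s)) := by
  intro W L
  have hW : W = fun s => IdealTuning.coeffIdeal f m s I :=
    funext fun s => IdealTuning.maxCoeffIdeal_eq_coeffIdeal f hI s
  clear_value W
  subst hW
  refine ⟨fun s => IdealTuning.coeffIdeal_antitone f m I s.le_succ,
    fun s t => IdealTuning.coeffIdeal_mul_le f m s t I,
    IdealTuning.derivIdeal_coeffIdeal f hm hI.le,
    fun s => IdealTuning.maxContactIdeal_coeffIdeal f hm hI, ?_,
    IdealTuning.maxOrd_coeffIdeal f hm hI,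
    fun s => IdealTuning.isMCInvariant_coeffIdeal f hm hI,
    fun r t => IdealTuning.coeffIdeal_mul_lcm_add f hm r,
    fun r j hr => IdealTuning.coeffIdeal_mul_lcm_pow f hm hr j, fun s hs => ?_⟩
  · rw [IdealTuning.maxContactIdeal, hI, ENat.toNat_natCast]
    exact IdealTuning.coeffIdeal_one f hm
  obtain ⟨⟨a, ha, rfl⟩, hpow⟩ := IdealTuning.exists_eq_mul_and_coeffIdeal_pow f (I := I) hm hs
  have hIW : I ^ a ≤ IdealTuning.coeffIdeal f m (a * m) I := by
    rw [mul_comm]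
    exact IdealTuning.iterDerivIdeal_pow_le_coeffIdeal f (j := 0) m.zero_le a
  have hGE : ∀ B : IdealTuning.SmoothBlowUpSeq f,
      B.HasOrderGE I m ↔ B.HasOrderGE (IdealTuning.coeffIdeal f m (a * m) I) (a * m) := fun B =>
    ⟨.of_le_coeffIdeal B le_rfl, .of_pow_le B ha hIW⟩
  have hm0 : m ≠ 0 := Nat.one_le_iff_ne_zero.1 hm
  exact ⟨IdealTuning.isMCInvariant_coeffIdeal f hm hI
      (Nat.one_le_iff_ne_zero.2 (mul_ne_zero ha hm0)),
    IdealTuning.isDBalanced_coeffIdeal f hm hI hpow,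
    -- The crossing condition on the centers does not involve the ideal.
    fun E _ B => and_congr_right fun _ => hGE B, hGE,
    fun B => IdealTuning.SmoothBlowUpSeq.HasOrderEq.hasOrderEq_iff B ha hm0 hIW le_rfl⟩

end
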